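/- INF (intuitionistic NF) is the first-order theory in the language with equality and one binary predicate $\in$, based on intuitionistic predicate logic, whose axioms are extensionality, $\forall x\,\forall y\,(\forall z\,(z\in x\leftrightarrow z\in y)\to x=y)$, and stratified comprehension: $\exists y\,\forall x\,(x\in y\leftrightarrow\varphi)$ (universally closed, $y$ not free in $\varphi$) for every formula $\varphi$ whose variables, bound and free, can be assigned natural-number indices such that in every subformula $u\in v$ the index of $v$ is one greater than that of $u$, and in every subformula $u=v$ both indices are equal. In INF put $\Lambda=\varnothing$, $\langle x,y\rangle=\{\{x\},\{x,y\}\}$, $\langle x,y,z\rangle=\langle\langle x,y\rangle,\{\{z\}\}\rangle$. Write $u\sim v$ if there is an $f$ such that for every $x\in u$ there is a unique $y\in v$ with $\langle x,y\rangle\in f$ (so $f:u\to v$), and $f$ is one-to-one (if $y\in v$ and $\langle x,y\rangle\in f$ then $x\in u$, and elements of $u$ with the same value in $v$ are equal) and onto $v$. Let $USC(a)=\{\{u\}:u\in a\}$ and let $SSC(a)=\{u: u\subseteq a\ \wedge\ a=u\cup(a-u)\}$ be the set of separable subsets of $a$. Let ${\sf zero}=\{\Lambda\}$ and $\kappa^+=\{z\cup\{c\}: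 z\in\kappa\ \wedge\ c\notin z\}$. Let $\mathbb F$ (finite cardinals) be the least set containing ${\sf zero}$ and containing $\kappa^+$ whenever it contains $\kappa$ and $\kappa^+$ is inhabited, and let $SF$ be the least set containing ${\sf zero}$ and closed under $\kappa\mapsto\kappa^+$ (least means: the intersection of all such sets). Let $$x+y=\{u\cup v: u\in x\ \wedge\ v\in y\ \wedge\ u\cap v=\Lambda\},\qquad 2^m=\{u:\exists a\,(USC(a)\in m\ \wedge\ u\sim SSC(a))\}.$$ Let $\mathbb G$ be the intersection of all $w$ such that $\langle x,{\sf zero},{\sf zero}\rangle\in w$ and $\langle{\sf zero},x,{\sf zero}\rangle\in w$ for all $x\in SF$, and $\langle x,y,z\rangle\in w$ implies $\langle x,y^+,z+x\rangle\in w$; and let $x\cdot y=\{u:\exists z\,(\langle x,y,z\rangle\in\mathbb G\ \wedge\ u\in z)\}$. **Lemma.** INF proves: for all $p$ and $q$ (for which the sets $p+q$, $2^{p+q}$, $2^p$, $2^q$ and $2^p\cdot 2^q$ exist), if $p,q\in\mathbb F$, $p+q\in\mathbb F$ and $2^{p+q}\in\mathbb F$, then $2^p\in\mathbb F$, $2^q\in\mathbb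 F$, $2^p\cdot 2^q\in\mathbb F$, and $$2^{p+q}=2^p\cdot 2^q.$$ -/

import Mathlib

/-! # Intuitionistic NF set theory (INF)

A deep embedding: formulas of the first-order language with `=` and `∈`, intuitionistic natural
deduction with equality, the theory INF (extensionality and stratified comprehension), and the
set-theoretic notions of the theory of finite Frege cardinals, as formulas. -/

namespace INF

/-! ## Formulas -/

/-- Formulas of the first-order language with equality and one binary predicate `∈`. Variables are
de Bruijn indices: under a quantifier, `0` is the variable just bound, and a variable called `n`
outside the quantifier is called `n + 1`. -/
inductive Fml : Type
  | bot : Fml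
  | eq : ℕ → ℕ → Fml
  | mem : ℕ → ℕ → Fml
  | and : Fml → Fml → Fml
  | or : Fml → Fml → Fml
  | imp : Fml → Fml → Fml
  | all : Fml → Fml
  | ex : Fml → Fml

/-- Negation: `φ → ⊥`. -/
def Fml.neg (φ : Fml) : Fml := Fml.imp φ Fml.bot

def Fml.iff (φ ψ : Fml) : Fml := Fml.and (Fml.imp φ ψ) (Fml.imp ψ φ)

infix:70 " =ᶠ " => Fml.eq
infix:70 " ∈ᶠ " => Fml.mem
infixr:65 " ∧ᶠ " => Fml.and
infixr:60 " ∨ᶠ " => Fml.or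
infixr:55 " →ᶠ " => Fml.imp
infix:50 " ↔ᶠ " => Fml.iff

/-- The sequence `a, σ 0, σ 1, …`. -/
def scons {α : Type} (a : α) (σ : ℕ → α) : ℕ → α
  | 0 => a
  | n + 1 => σ n

/-- Simultaneous capture-avoiding substitution of the variable `f n` for each free variable `n`.
(The language has no terms but variables.) -/
def Fml.ren : (ℕ → ℕ) → Fml → Fml
  | _, .bot => .bot
  | f, .eq x y => .eq (f x) (f y)
  | f, .mem x y => .mem (f x) (f y)
  | f, .and φ ψ => .and (φ.ren f) (ψ.ren f)
  | f, .or φ ψ => .or (φ.ren f) (ψ.ren f)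
  | f, .imp φ ψ => .imp (φ.ren f) (ψ.ren f)
  | f, .all φ => .all (φ.ren (scons 0 (fun n => f n + 1)))
  | f, .ex φ => .ex (φ.ren (scons 0 (fun n => f n + 1)))

/-- Weakening: the formula `φ` read under one more quantifier, whose variable it does not use. -/
def Fml.wk (φ : Fml) : Fml := φ.ren Nat.succ

/-- Instantiation: for a formula `φ` that stands under a quantifier, `φ.inst t` is the result of
replacing the quantified variable `0` by the variable `t`. -/
def Fml.inst (φ : Fml) (t : ℕ) : Fml := φ.ren (scons t id)

/-! ## Intuitionistic provability -/

/-- `Proves T Γ φ`: intuitionistic natural deduction of `φ` from the assumptions `Γ` in the theory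
`T`. The free variables of the members of `T` are understood as universally quantified, so every
substitution instance of a member of `T` may be used; those of `Γ` are held fixed. -/
inductive Proves (T : Set Fml) : List Fml → Fml → Prop
  | thy {Γ : List Fml} {φ : Fml} (f : ℕ → ℕ) : φ ∈ T → Proves T Γ (φ.ren f)
  | hyp {Γ : List Fml} {φ : Fml} : φ ∈ Γ → Proves T Γ φ
  | botE {Γ : List Fml} {φ : Fml} : Proves T Γ .bot → Proves T Γ φ
  | andI {Γ : List Fml} {φ ψ : Fml} : Proves T Γ φ → Proves T Γ ψ → Proves T Γ (φ ∧ᶠ ψ)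
  | andE₁ {Γ : List Fml} {φ ψ : Fml} : Proves T Γ (φ ∧ᶠ ψ) → Proves T Γ φ
  | andE₂ {Γ : List Fml} {φ ψ : Fml} : Proves T Γ (φ ∧ᶠ ψ) → Proves T Γ ψ
  | orI₁ {Γ : List Fml} {φ ψ : Fml} : Proves T Γ φ → Proves T Γ (φ ∨ᶠ ψ)
  | orI₂ {Γ : List Fml} {φ ψ : Fml} : Proves T Γ ψ → Proves T Γ (φ ∨ᶠ ψ)
  | orE {Γ : List Fml} {φ ψ χ : Fml} : Proves T Γ (φ ∨ᶠ ψ) →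
      Proves T (φ :: Γ) χ → Proves T (ψ :: Γ) χ → Proves T Γ χ
  | impI {Γ : List Fml} {φ ψ : Fml} : Proves T (φ :: Γ) ψ → Proves T Γ (φ →ᶠ ψ)
  | impE {Γ : List Fml} {φ ψ : Fml} : Proves T Γ (φ →ᶠ ψ) → Proves T Γ φ → Proves T Γ ψ
  | allI {Γ : List Fml} {φ : Fml} : Proves T (Γ.map Fml.wk) φ → Proves T Γ (.all φ)
  | allE {Γ : List Fml} {φ : Fml} (t : ℕ) : Proves T Γ (.all φ) → Proves T Γ (φ.inst t)
  | exI {Γ : List Fml} {φ : Fml} (t : ℕ) : Proves T Γ (φ.inst t) → Proves T Γ (.ex φ)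
  | exE {Γ : List Fml} {φ ψ : Fml} : Proves T Γ (.ex φ) →
      Proves T (φ :: Γ.map Fml.wk) ψ.wk → Proves T Γ ψ
  | eqI {Γ : List Fml} (t : ℕ) : Proves T Γ (t =ᶠ t)
  | eqE {Γ : List Fml} {φ : Fml} {s t : ℕ} : Proves T Γ (s =ᶠ t) →
      Proves T Γ (φ.inst s) → Proves T Γ (φ.inst t)

/-! ## The theory INF -/

/-- `φ.StratBy σ`: the assignment `σ` of indices to the free variables of `φ` extends to the bound
variables so that in `x ∈ y` the index of `y` is one greater than that of `x`, and in `x = y` both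
have the same index. -/
def Fml.StratBy : (ℕ → ℕ) → Fml → Prop
  | _, .bot => True
  | σ, .eq x y => σ x = σ y
  | σ, .mem x y => σ y = σ x + 1
  | σ, .and φ ψ => φ.StratBy σ ∧ ψ.StratBy σ
  | σ, .or φ ψ => φ.StratBy σ ∧ ψ.StratBy σ
  | σ, .imp φ ψ => φ.StratBy σ ∧ ψ.StratBy σ
  | σ, .all φ => ∃ k : ℕ, φ.StratBy (scons k σ)
  | σ, .ex φ => ∃ k : ℕ, φ.StratBy (scons k σ)

def Fml.Stratified (φ : Fml) : Prop := ∃ σ : ℕ → ℕ, φ.StratBy σ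

/-- Extensionality: `∀ x y, (∀ z, z ∈ x ↔ z ∈ y) → x = y`. -/
def extensionality : Fml := .all (.all (.all (0 ∈ᶠ 2 ↔ᶠ 0 ∈ᶠ 1) →ᶠ 1 =ᶠ 0))

/-- Comprehension for `φ`, whose variable `0` is the eigenvariable `x` and whose other free
variables are parameters: `∃ y, ∀ x, x ∈ y ↔ φ`. The substitution makes room for `y`. -/
def comprehension (φ : Fml) : Fml :=
  .ex (.all (0 ∈ᶠ 1 ↔ᶠ φ.ren (scons 0 (fun n => n + 2))))

/-- The theory INF. -/
def theory : Set Fml :=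
  {χ | χ = extensionality ∨ ∃ φ : Fml, φ.Stratified ∧ χ = comprehension φ}

/-- `INF ⊢ φ`. -/
def Provable (φ : Fml) : Prop := Proves theory [] φ

/-! ## Sets and functions

Below, every argument of type `ℕ` is a variable. A formula `isX z …` says that `z` is the set that
the informal notation `X …` denotes. Inside the quantifiers, the variables are renamed as the de
Bruijn convention demands. -/

/-- `z` is the empty set `Λ`. -/
def isEmpty (z : ℕ) : Fml := .all (0 ∈ᶠ (z + 1)).neg

/-- `∃ u, u ∈ z`. -/
def inhabited (z : ℕ) : Fml := .ex (0 ∈ᶠ (z + 1))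

/-- `a ⊆ b`. -/
def subset (a b : ℕ) : Fml := .all (0 ∈ᶠ (a + 1) →ᶠ 0 ∈ᶠ (b + 1))

/-- `z = {x}`. -/
def isSingleton (z x : ℕ) : Fml := .all (0 ∈ᶠ (z + 1) ↔ᶠ 0 =ᶠ (x + 1))

/-- `z = {x, y}`. -/
def isUPair (z x y : ℕ) : Fml := .all (0 ∈ᶠ (z + 1) ↔ᶠ 0 =ᶠ (x + 1) ∨ᶠ 0 =ᶠ (y + 1))

/-- `z = a ∪ b`. -/
def isUnion (z a b : ℕ) : Fml := .all (0 ∈ᶠ (z + 1) ↔ᶠ 0 ∈ᶠ (a + 1) ∨ᶠ 0 ∈ᶠ (b + 1))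

/-- `z = a ∪ {c}`. -/
def isAdjoin (z a c : ℕ) : Fml := .all (0 ∈ᶠ (z + 1) ↔ᶠ 0 ∈ᶠ (a + 1) ∨ᶠ 0 =ᶠ (c + 1))

/-- `a ∩ b = Λ`. -/
def disjoint (a b : ℕ) : Fml := .all (0 ∈ᶠ (a + 1) ∧ᶠ 0 ∈ᶠ (b + 1)).neg

/-- `z` is the ordered pair `⟨x, y⟩ = {{x}, {x, y}}`. -/
def isPair (z x y : ℕ) : Fml :=
  .all (0 ∈ᶠ (z + 1) ↔ᶠ isSingleton 0 (x + 1) ∨ᶠ isUPair 0 (x + 1) (y + 1))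

/-- `⟨x, y⟩ ∈ f`. -/
def pairMem (x y f : ℕ) : Fml := .ex (isPair 0 (x + 1) (y + 1) ∧ᶠ 0 ∈ᶠ (f + 1))

/-- `t` is the ordered triple `⟨x, y, z⟩ = ⟨⟨x, y⟩, {{z}}⟩`. -/
def isTriple (t x y z : ℕ) : Fml :=
  .ex (.ex (.ex (isPair 2 (x + 3) (y + 3) ∧ᶠ isSingleton 1 (z + 3) ∧ᶠ isSingleton 0 1 ∧ᶠ
    isPair (t + 3) 2 0)))

/-- `⟨x, y, z⟩ ∈ w`. -/
def tripleMem (x y z w : ℕ) : Fml :=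
  .ex (isTriple 0 (x + 1) (y + 1) (z + 1) ∧ᶠ 0 ∈ᶠ (w + 1))

/-- `f : a → b`: for every `x ∈ a` there is a unique `y ∈ b` with `⟨x, y⟩ ∈ f`. -/
def mapsTo (f a b : ℕ) : Fml :=
  .all (0 ∈ᶠ (a + 1) →ᶠ .ex (0 ∈ᶠ (b + 2) ∧ᶠ pairMem 1 0 (f + 2) ∧ᶠ
    .all (0 ∈ᶠ (b + 3) ∧ᶠ pairMem 2 0 (f + 3) →ᶠ 0 =ᶠ 1)))

/-- `f : a → b` is one-to-one: if `y ∈ b` and `⟨x, y⟩ ∈ f` then `x ∈ a`; and members `x`, `z` of `a`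
with the same value `y ∈ b` are equal. -/
def oneToOne (f a b : ℕ) : Fml :=
  .all (.all (0 ∈ᶠ (b + 2) ∧ᶠ pairMem 1 0 (f + 2) →ᶠ 1 ∈ᶠ (a + 2))) ∧ᶠ
  .all (.all (.all (2 ∈ᶠ (a + 3) ∧ᶠ 1 ∈ᶠ (a + 3) ∧ᶠ 0 ∈ᶠ (b + 3) ∧ᶠ
    pairMem 2 0 (f + 3) ∧ᶠ pairMem 1 0 (f + 3) →ᶠ 2 =ᶠ 1)))

/-- `f : a → b` is onto. -/
def onto (f a b : ℕ) : Fml :=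
  .all (0 ∈ᶠ (b + 1) →ᶠ .ex (0 ∈ᶠ (a + 2) ∧ᶠ pairMem 0 1 (f + 2)))

/-- Similarity `a ∼ b`: some `f : a → b` is one-to-one and onto. -/
def similar (a b : ℕ) : Fml :=
  .ex (mapsTo 0 (a + 1) (b + 1) ∧ᶠ oneToOne 0 (a + 1) (b + 1) ∧ᶠ onto 0 (a + 1) (b + 1))

/-- `z = USC(a)`, the set of the singletons `{u}` with `u ∈ a`. -/
def isUSC (z a : ℕ) : Fml := .all (0 ∈ᶠ (z + 1) ↔ᶠ .ex (0 ∈ᶠ (a + 2) ∧ᶠ isSingleton 1 0))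

/-- `z = SSC(a)`, the set of the separable subsets of `a`, that is, of all `u` such that
`u ⊆ a` and `a = u ∪ (a - u)`. -/
def isSSC (z a : ℕ) : Fml :=
  .all (0 ∈ᶠ (z + 1) ↔ᶠ subset 0 (a + 1) ∧ᶠ
    .all (0 ∈ᶠ (a + 2) ↔ᶠ 0 ∈ᶠ 1 ∨ᶠ (0 ∈ᶠ (a + 2) ∧ᶠ (0 ∈ᶠ 1).neg)))

/-! ## Frege cardinals -/

/-- `z` is Frege zero `{Λ}`. -/
def isZero (z : ℕ) : Fml := .all (0 ∈ᶠ (z + 1) ↔ᶠ isEmpty 0)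

/-- `zero ∈ w`. -/
def zeroMem (w : ℕ) : Fml := .ex (isZero 0 ∧ᶠ 0 ∈ᶠ (w + 1))

/-- `s = κ⁺`, the set of all `x = z ∪ {c}` with `z ∈ κ` and `c ∉ z`. -/
def isSucc (s κ : ℕ) : Fml :=
  .all (0 ∈ᶠ (s + 1) ↔ᶠ .ex (.ex (1 ∈ᶠ (κ + 3) ∧ᶠ (0 ∈ᶠ 1).neg ∧ᶠ isAdjoin 2 1 0)))

/-- `κ ∈ 𝔽`: `κ` belongs to every `w` that contains zero and contains `μ⁺` whenever it contains `μ`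
and `μ⁺` is inhabited. -/
def memF (κ : ℕ) : Fml :=
  .all (zeroMem 0 ∧ᶠ .all (.all (1 ∈ᶠ 2 ∧ᶠ isSucc 0 1 ∧ᶠ inhabited 0 →ᶠ 0 ∈ᶠ 2)) →ᶠ
    (κ + 1) ∈ᶠ 0)

/-- `κ ∈ SF`: `κ` belongs to every `w` that contains zero and is closed under successor. -/
def memSF (κ : ℕ) : Fml :=
  .all (zeroMem 0 ∧ᶠ .all (.all (1 ∈ᶠ 2 ∧ᶠ isSucc 0 1 →ᶠ 0 ∈ᶠ 2)) →ᶠ (κ + 1) ∈ᶠ 0)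

/-- `z = x + y`, the set of all `u ∪ v` with `u ∈ x`, `v ∈ y` and `u ∩ v = Λ`. -/
def isAdd (z x y : ℕ) : Fml :=
  .all (0 ∈ᶠ (z + 1) ↔ᶠ .ex (.ex (1 ∈ᶠ (x + 3) ∧ᶠ 0 ∈ᶠ (y + 3) ∧ᶠ disjoint 1 0 ∧ᶠ
    isUnion 2 1 0)))

/-- `e = 2 ^ m`, the set of all `u` such that `u ∼ SSC(a)` for some `a` with `USC(a) ∈ m`. -/
def isExp (e m : ℕ) : Fml :=
  .all (0 ∈ᶠ (e + 1) ↔ᶠ .ex (.ex (isUSC 0 1 ∧ᶠ 0 ∈ᶠ (m + 3)) ∧ᶠ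
    .ex (isSSC 0 1 ∧ᶠ similar 2 0)))

/-- The relation `w` satisfies the three closure conditions that define multiplication:
`⟨x, zero, zero⟩ ∈ w` and `⟨zero, x, zero⟩ ∈ w` for `x ∈ SF`,
and `⟨x, y, z⟩ ∈ w` implies `⟨x, y⁺, z + x⟩ ∈ w`. -/
def mulClosed (w : ℕ) : Fml :=
  .all (.all (memSF 1 ∧ᶠ isZero 0 →ᶠ tripleMem 1 0 0 (w + 2))) ∧ᶠ
  .all (.all (memSF 1 ∧ᶠ isZero 0 →ᶠ tripleMem 0 1 0 (w + 2))) ∧ᶠ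
  .all (.all (.all (.all (.all (tripleMem 4 3 2 (w + 5) ∧ᶠ isSucc 1 3 ∧ᶠ isAdd 0 2 4 →ᶠ
    tripleMem 4 1 0 (w + 5))))))

/-- `⟨x, y, z⟩ ∈ 𝔾`, where `𝔾` is the intersection of all `w` that satisfy `mulClosed`. -/
def memG (x y z : ℕ) : Fml := .all (mulClosed 0 →ᶠ tripleMem (x + 1) (y + 1) (z + 1) 0)

/-- `m = x · y`, the set of all `u` such that `u ∈ z` for some `z` with `⟨x, y, z⟩ ∈ 𝔾`. -/
def isMul (m x y : ℕ) : Fml :=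
  .all (0 ∈ᶠ (m + 1) ↔ᶠ .ex (memG (x + 2) (y + 2) 0 ∧ᶠ 1 ∈ᶠ 0))

end INF

namespace INF

/-! ## Renaming -/

/-! No derivation in INF is written down. Intuitionistic logic is complete for Kripke semantics
(`proves_of_force`), so it suffices that every Kripke model of INF forces the statement at every
world. The worlds of the canonical model are prime theories with witnesses, and its transitions are
renamings of variables.

In a model, comprehension gives each operation as an actual element of a world, and extensionality
makes this choice commute with transitions (`map_compr`). The forced formulas then become ordinary
statements about these elements, with implications and universal quantifiers ranging over all later
worlds. An induction over 𝔽, SF or 𝔾 applies the definition of the class to a set given by a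
stratified formula, and its closure conditions have to hold at all later worlds.

The arithmetic runs as follows. A finite cardinal is inhabited (`InF.nonempty`) and is a full
similarity class (`InF.sim_iff`), so two finite cardinals with a common member are equal (`InF.eq`).
A member of 2^(p+q) yields a set a with USC(a) ∈ p+q, and a splits into disjoint a₁, a₂ with USC(a₁)
∈ p and USC(a₂) ∈ q. By induction on the exponent, SSC(aᵢ) lies in a finite cardinal, which is 2^p
or 2^q (`InF.exp_of_usc_mem`); the successor step is 2^(p+1) = 2^p + 2^p.

The separable subsets of a₁ ∪ a₂ are exactly the unions of separable subsets of a₁ and of a₂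
(`unions_ssc`). On the other side, induction over 𝔾 shows that whenever ⟨2^p, 2^q, z⟩ ∈ 𝔾, the
cardinal z is finite and contains the set of these unions (`InG.unions_mem`). So z and 2^(p+q) are
finite cardinals sharing the member SSC(a), hence equal. Such a z exists by induction over SF
(`InSF.exists_inG`), so the product, the union of all such z, is 2^(p+q). In this way no general
theory of multiplication is needed. -/

theorem Fml.ren_congr {f g : ℕ → ℕ} (h : ∀ n, f n = g n) (φ : Fml) : φ.ren f = φ.ren g := by
  rw [funext h]

theorem scons_comp {α β : Type} (k : α → β) (a : α) (σ : ℕ → α) (n : ℕ) :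
    k (scons a σ n) = scons (k a) (fun n => k (σ n)) n := by
  cases n <;> rfl

theorem Fml.ren_ren (φ : Fml) (f g : ℕ → ℕ) : (φ.ren f).ren g = φ.ren (fun n => g (f n)) := by
  induction φ generalizing f g with
  | bot | eq | mem => rfl
  | and _ _ ih₁ ih₂ | or _ _ ih₁ ih₂ | imp _ _ ih₁ ih₂ => simp [Fml.ren, ih₁, ih₂]
  | all _ ih | ex _ ih =>
    simp only [Fml.ren, ih]
    congr 1
    apply Fml.ren_congr
    rintro (_ | n) <;> rfl

theorem scons_zero_succ (n : ℕ) : scons 0 (fun n => n + 1) n = n := by cases n <;> rfl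

theorem Fml.ren_id (φ : Fml) : φ.ren (fun n => n) = φ := by
  induction φ with
  | bot | eq | mem => rfl
  | and _ _ ih₁ ih₂ | or _ _ ih₁ ih₂ | imp _ _ ih₁ ih₂ => simp [Fml.ren, ih₁, ih₂]
  | all _ ih | ex _ ih =>
    simp only [Fml.ren]
    rw [Fml.ren_congr scons_zero_succ, ih]

theorem Fml.wk_ren (φ : Fml) (f : ℕ → ℕ) :
    φ.wk.ren (scons 0 (fun n => f n + 1)) = (φ.ren f).wk := by
  simp only [Fml.wk, Fml.ren_ren]
  rfl

theorem Fml.inst_ren (φ : Fml) (t : ℕ) (f : ℕ → ℕ) :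
    (φ.inst t).ren f = (φ.ren (scons 0 (fun n => f n + 1))).inst (f t) := by
  simp only [Fml.inst, Fml.ren_ren]
  apply Fml.ren_congr
  rintro (_ | n) <;> rfl

/-- Stands in for the finiteness of the set of free variables; it supplies fresh variables for
witnesses. -/
theorem Fml.exists_bound (φ : Fml) :
    ∃ N, ∀ f g : ℕ → ℕ, (∀ n < N, f n = g n) → φ.ren f = φ.ren g := by
  induction φ with
  | bot => exact ⟨0, fun _ _ _ => rfl⟩
  | eq x y | mem x y =>
    refine ⟨x + y + 1, fun f g h => ?_⟩
    simp only [Fml.ren]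
    rw [h x (by omega), h y (by omega)]
  | and φ ψ ih₁ ih₂ | or φ ψ ih₁ ih₂ | imp φ ψ ih₁ ih₂ =>
    obtain ⟨N, hN⟩ := ih₁
    obtain ⟨K, hK⟩ := ih₂
    refine ⟨N + K, fun f g h => ?_⟩
    simp only [Fml.ren]
    rw [hN f g fun n hn => h n (by omega), hK f g fun n hn => h n (by omega)]
  | all φ ih | ex φ ih =>
    obtain ⟨N, hN⟩ := ih
    refine ⟨N, fun f g h => ?_⟩
    simp only [Fml.ren]
    rw [hN _ (scons 0 (fun n => g n + 1))]
    rintro (_ | n) hn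
    · rfl
    · simp [scons, h n (by omega)]

/-! ## Derivations -/

theorem Proves.weaken {T : Set Fml} {Γ Δ : List Fml} {φ : Fml} (h : Proves T Γ φ) (hs : Γ ⊆ Δ) :
    Proves T Δ φ := by
  induction h generalizing Δ with
  | thy f h => exact .thy f h
  | hyp h => exact .hyp (hs h)
  | botE _ ih => exact .botE (ih hs)
  | andI _ _ ih₁ ih₂ => exact .andI (ih₁ hs) (ih₂ hs)
  | andE₁ _ ih => exact .andE₁ (ih hs)
  | andE₂ _ ih => exact .andE₂ (ih hs)
  | orI₁ _ ih => exact .orI₁ (ih hs)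
  | orI₂ _ ih => exact .orI₂ (ih hs)
  | orE _ _ _ ih ih₁ ih₂ =>
    exact .orE (ih hs) (ih₁ (List.cons_subset_cons _ hs)) (ih₂ (List.cons_subset_cons _ hs))
  | impI _ ih => exact .impI (ih (List.cons_subset_cons _ hs))
  | impE _ _ ih₁ ih₂ => exact .impE (ih₁ hs) (ih₂ hs)
  | allI _ ih => exact .allI (ih (List.map_subset _ hs))
  | allE t _ ih => exact .allE t (ih hs)
  | exI t _ ih => exact .exI t (ih hs)
  | exE _ _ ih₁ ih₂ => exact .exE (ih₁ hs) (ih₂ (List.cons_subset_cons _ (List.map_subset _ hs)))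
  | eqI t => exact .eqI t
  | eqE _ _ ih₁ ih₂ => exact .eqE (ih₁ hs) (ih₂ hs)

theorem map_wk_ren (Γ : List Fml) (f : ℕ → ℕ) :
    (Γ.map Fml.wk).map (Fml.ren (scons 0 (fun n => f n + 1))) =
      (Γ.map (Fml.ren f)).map Fml.wk := by
  simp [Function.comp_def, Fml.wk_ren]

theorem Proves.ren {T : Set Fml} {Γ : List Fml} {φ : Fml} (h : Proves T Γ φ) (f : ℕ → ℕ) :
    Proves T (Γ.map (Fml.ren f)) (φ.ren f) := by
  induction h generalizing f with
  | thy g h => rw [Fml.ren_ren]; exact .thy _ h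
  | hyp h => exact .hyp (List.mem_map_of_mem h)
  | botE _ ih => exact .botE (ih f)
  | andI _ _ ih₁ ih₂ => exact .andI (ih₁ f) (ih₂ f)
  | andE₁ _ ih => exact .andE₁ (ih f)
  | andE₂ _ ih => exact .andE₂ (ih f)
  | orI₁ _ ih => exact .orI₁ (ih f)
  | orI₂ _ ih => exact .orI₂ (ih f)
  | orE _ _ _ ih ih₁ ih₂ => exact .orE (ih f) (ih₁ f) (ih₂ f)
  | impI _ ih => exact .impI (ih f)
  | impE _ _ ih₁ ih₂ => exact .impE (ih₁ f) (ih₂ f)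
  | allI _ ih => exact .allI (map_wk_ren _ f ▸ ih _)
  | allE t _ ih => rw [Fml.inst_ren]; exact .allE _ (ih f)
  | exI t _ ih => exact .exI (f t) (Fml.inst_ren _ _ _ ▸ ih f)
  | exE _ _ ih₁ ih₂ =>
    refine .exE (ih₁ f) ?_
    have := ih₂ (scons 0 (fun n => f n + 1))
    rwa [List.map_cons, map_wk_ren, Fml.wk_ren] at this
  | eqI t => exact .eqI _
  | eqE _ _ ih₁ ih₂ =>
    rw [Fml.inst_ren]
    exact .eqE (ih₁ f) (Fml.inst_ren _ _ _ ▸ ih₂ f)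

/-- Derivability from a set of assumptions. -/
def Derives (T S : Set Fml) (φ : Fml) : Prop := ∃ Γ : List Fml, (∀ ψ ∈ Γ, ψ ∈ S) ∧ Proves T Γ φ

theorem Derives.mono {T S S' : Set Fml} {φ : Fml} (h : Derives T S φ) (hs : S ⊆ S') :
    Derives T S' φ := by
  obtain ⟨Γ, hΓ, h⟩ := h
  exact ⟨Γ, fun ψ hψ => hs (hΓ ψ hψ), h⟩

theorem Derives.hyp {T S : Set Fml} {φ : Fml} (h : φ ∈ S) : Derives T S φ :=
  ⟨[φ], by simpa using h, .hyp (by simp)⟩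

theorem Derives.of_proves {T S : Set Fml} {φ : Fml} (h : Proves T [] φ) : Derives T S φ :=
  ⟨[], by simp, h⟩

theorem Derives.imp {T S : Set Fml} {φ ψ : Fml} (h : Derives T (insert φ S) ψ) :
    Derives T S (φ →ᶠ ψ) := by
  classical
  obtain ⟨Γ, hΓ, h⟩ := h
  refine ⟨Γ.filter (· ≠ φ), fun χ hχ => ?_, .impI (h.weaken fun χ hχ => ?_)⟩
  · simp only [ne_eq, List.mem_filter, decide_eq_true_eq] at hχ
    exact (hΓ χ hχ.1).resolve_left hχ.2
  · by_cases hc : χ = φ <;> simp [hc, hχ]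

theorem Derives.mp {T S : Set Fml} {φ ψ : Fml} (h₁ : Derives T S (φ →ᶠ ψ)) (h₂ : Derives T S φ) :
    Derives T S ψ := by
  obtain ⟨Γ, hΓ, h₁⟩ := h₁
  obtain ⟨Δ, hΔ, h₂⟩ := h₂
  refine ⟨Γ ++ Δ, fun χ hχ => ?_, .impE (h₁.weaken (by simp)) (h₂.weaken (by simp))⟩
  rcases List.mem_append.1 hχ with h | h
  exacts [hΓ χ h, hΔ χ h]

theorem Derives.lift {T S : Set Fml} {φ ψ : Fml} (h : Proves T [φ] ψ) (h₁ : Derives T S φ) :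
    Derives T S ψ :=
  .mp (.of_proves (.impI h)) h₁

theorem Derives.lift₂ {T S : Set Fml} {φ ψ χ : Fml} (h : Proves T [ψ, φ] χ) (h₁ : Derives T S φ)
    (h₂ : Derives T S ψ) : Derives T S χ :=
  .mp (.mp (.of_proves (.impI (.impI h))) h₁) h₂

theorem Derives.or_elim {T S : Set Fml} {φ ψ χ : Fml} (h : Derives T S (φ ∨ᶠ ψ))
    (h₁ : Derives T (insert φ S) χ) (h₂ : Derives T (insert ψ S) χ) : Derives T S χ := by
  have h₃ := h₁.imp
  have h₄ := h₂.imp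
  refine .mp (.lift₂ (φ := φ →ᶠ χ) (ψ := ψ →ᶠ χ) (.impI (.orE (φ := φ) (ψ := ψ) (.hyp (by simp)) ?_ ?_)) h₃ h₄) h
  · exact .impE (.hyp (φ := φ →ᶠ χ) (by simp)) (.hyp (by simp))
  · exact .impE (.hyp (φ := ψ →ᶠ χ) (by simp)) (.hyp (by simp))

theorem Derives.ren {T S : Set Fml} {φ : Fml} (h : Derives T S φ) (f : ℕ → ℕ) :
    Derives T (Fml.ren f '' S) (φ.ren f) := by
  obtain ⟨Γ, hΓ, h⟩ := h
  refine ⟨_, fun ψ hψ => ?_, h.ren f⟩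
  obtain ⟨χ, hχ, rfl⟩ := List.mem_map.1 hψ
  exact ⟨χ, hΓ χ hχ, rfl⟩

theorem Derives.all {T S : Set Fml} {φ : Fml} (h : Derives T (Fml.wk '' S) φ) :
    Derives T S (.all φ) := by
  obtain ⟨Γ, hΓ, h⟩ := h
  choose! g hg hg' using hΓ
  refine ⟨Γ.map g, fun ψ hψ => ?_, .allI (h.weaken fun ψ hψ => ?_)⟩
  · obtain ⟨χ, hχ, rfl⟩ := List.mem_map.1 hψ
    exact hg χ hχ
  · rw [List.map_map]
    exact List.mem_map.2 ⟨ψ, hψ, hg' ψ hψ⟩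

/-- The variable `c` does not occur free in `φ`. -/
def Fml.Fresh (c : ℕ) (φ : Fml) : Prop :=
  ∀ f g : ℕ → ℕ, (∀ n, n ≠ c → f n = g n) → φ.ren f = φ.ren g

theorem Fml.fresh_of_bound {φ : Fml} {N c : ℕ}
    (h : ∀ f g : ℕ → ℕ, (∀ n < N, f n = g n) → φ.ren f = φ.ren g) (hc : N ≤ c) : φ.Fresh c :=
  fun f g hfg => h f g fun n hn => hfg n (by omega)

/-- Elimination of an existential quantifier by a fresh variable. -/
theorem Derives.of_fresh {T S : Set Fml} {φ χ : Fml} {c : ℕ} (hS : ∀ ψ ∈ S, ψ.Fresh c)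
    (hφ : (Fml.ex φ).Fresh c) (hχ : χ.Fresh c) (h : Derives T (insert (φ.inst c) S) χ)
    (he : Derives T S (.ex φ)) : Derives T S χ := by
  -- Sending c to the bound variable and shifting the rest turns the instance at c back into the
  -- body, as the existential elimination rule wants it.
  let f : ℕ → ℕ := fun n => if n = c then 0 else n + 1
  have hf : ∀ ψ : Fml, ψ.Fresh c → ψ.ren f = ψ.wk := fun ψ hψ =>
    hψ _ _ fun n hn => by simp [f, hn]
  have hi : (φ.inst c).ren f = φ := by
    -- Freshness lets c be moved out of the way inside the body, so that only the bound variable is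
    -- sent to c by the instantiation.
    have h₂ := hφ (fun n => n) (fun n => if n = c then c + 1 else n) fun n hn => by simp [hn]
    rw [Fml.ren_id] at h₂
    simp only [Fml.ren, Fml.ex.injEq] at h₂
    rw [Fml.inst, Fml.ren_ren]
    nth_rw 1 [h₂]
    rw [Fml.ren_ren]
    nth_rw 2 [h₂]
    apply Fml.ren_congr
    rintro (_ | n)
    · simp [scons, f]
    · by_cases hn : n = c <;> simp [scons, f, hn]
  obtain ⟨Γ, hΓ, h⟩ := h.imp
  refine .mp ?_ he
  refine ⟨Γ, hΓ, .impI (.exE (φ := φ) (.hyp (by simp)) ?_)⟩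
  have := h.ren f
  rw [Fml.ren, hi, hf χ hχ, List.map_congr_left fun ψ hψ => hf ψ (hS ψ (hΓ ψ hψ))] at this
  exact .impE (this.weaken fun ψ hψ => by
    obtain ⟨a, ha, rfl⟩ := List.mem_map.1 hψ
    simp only [List.map_cons, List.mem_cons, List.mem_map]
    exact .inr (.inr ⟨a, ha, rfl⟩)) (.hyp (by simp))

/-! ## Prime theories -/

/-- An injective coding of formulas. -/
def Fml.code : Fml → ℕ
  | .bot => Nat.pair 0 0
  | .eq x y => Nat.pair 1 (Nat.pair x y)
  | .mem x y => Nat.pair 2 (Nat.pair x y)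
  | .and φ ψ => Nat.pair 3 (Nat.pair φ.code ψ.code)
  | .or φ ψ => Nat.pair 4 (Nat.pair φ.code ψ.code)
  | .imp φ ψ => Nat.pair 5 (Nat.pair φ.code ψ.code)
  | .all φ => Nat.pair 6 φ.code
  | .ex φ => Nat.pair 7 φ.code

instance : Countable Fml := by
  have : Function.Injective Fml.code := by
    intro φ ψ h
    induction φ generalizing ψ <;> cases ψ <;>
      simp only [Fml.code, Nat.pair_eq_pair] at h <;> grind
  exact this.countable

/-- A deductively closed, consistent, prime theory with witnesses for its existential members. -/
structure PrimeTheory (T : Set Fml) where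
  carrier : Set Fml
  closed : ∀ φ, Derives T carrier φ → φ ∈ carrier
  consistent : Fml.bot ∉ carrier
  prime : ∀ φ ψ, (φ ∨ᶠ ψ) ∈ carrier → φ ∈ carrier ∨ ψ ∈ carrier
  witness : ∀ φ, Fml.ex φ ∈ carrier → ∃ t, φ.inst t ∈ carrier

/-- One step of the Henkin construction: χ joins the finite set if φ remains underivable, and an
existential χ brings along its instance at a fresh variable, which is harmless by
`Derives.of_fresh`. -/
theorem exists_stage {T S : Set Fml} {φ : Fml} (hS : ∀ N, ∃ c ≥ N, ∀ ψ ∈ S, ψ.Fresh c) (χ : Fml)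
    (L : {L : Finset Fml // ¬ Derives T (S ∪ L) φ}) :
    ∃ L' : {L : Finset Fml // ¬ Derives T (S ∪ L) φ}, L.1 ⊆ L'.1 ∧
      (χ ∈ L'.1 ∨ Derives T (insert χ (S ∪ L.1)) φ) ∧
      ∀ ψ, χ = .ex ψ → χ ∈ L'.1 → ∃ c, ψ.inst c ∈ L'.1 := by
  classical
  obtain ⟨L, hL⟩ := L
  by_cases hd : Derives T (insert χ (S ∪ L)) φ
  · by_cases hχ : χ ∈ L
    · exact absurd (hd.mono (Set.insert_subset (.inr hχ) subset_rfl)) hL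
    · exact ⟨⟨L, hL⟩, subset_rfl, .inr hd, fun ψ _ h => absurd h hχ⟩
  have hL' : ¬ Derives T (S ∪ (insert χ L : Finset Fml)) φ := by
    simpa [Set.union_insert] using hd
  by_cases hex : ∃ ψ, χ = .ex ψ
  · obtain ⟨ψ, rfl⟩ := hex
    choose b hb using Fml.exists_bound
    -- The sum exceeds the bound of each formula involved, so c is fresh for all of them at once.
    obtain ⟨c, hc, hcS⟩ := hS (b φ + ∑ χ ∈ insert (.ex ψ) L, b χ)
    have hfr : ∀ χ ∈ insert (Fml.ex ψ) L, χ.Fresh c := fun χ hχ => Fml.fresh_of_bound (hb χ) (by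
      have := Finset.single_le_sum (fun i _ => Nat.zero_le (b i)) hχ
      omega)
    refine ⟨⟨insert (ψ.inst c) (insert (.ex ψ) L), fun h => hL' ?_⟩, ?_, ?_, ?_⟩
    · refine Derives.of_fresh (c := c) (φ := ψ) ?_ (hfr _ (by simp)) ?_ ?_ (.hyp (by simp))
      · rintro χ (hχ | hχ)
        exacts [hcS χ hχ, hfr χ hχ]
      · exact Fml.fresh_of_bound (hb φ) (by omega)
      · rwa [Finset.coe_insert, Set.union_insert] at h
    · intro x hx
      simp [hx]
    · simp
    · rintro _ ⟨⟩ _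
      exact ⟨c, by simp⟩
  · exact ⟨⟨_, hL'⟩, Finset.subset_insert _ _, .inl (by simp), fun ψ h => absurd ⟨ψ, h⟩ hex⟩

/-- The theory is the union of the stages along an enumeration of all formulas. Any formula left out
would derive φ together with it; this gives closure by cut and primeness by elimination of
disjunctions. -/
theorem exists_primeTheory_of_fresh {T S : Set Fml} {φ : Fml}
    (hS : ∀ N, ∃ c ≥ N, ∀ ψ ∈ S, ψ.Fresh c) (h : ¬ Derives T S φ) :
    ∃ w : PrimeTheory T, S ⊆ w.carrier ∧ φ ∉ w.carrier := by
  have : Nonempty Fml := ⟨.bot⟩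
  obtain ⟨e, he⟩ := exists_surjective_nat Fml
  choose step hs₁ hs₂ hs₃ using exists_stage (T := T) (φ := φ) hS
  let L : ℕ → {L : Finset Fml // ¬ Derives T (S ∪ L) φ} := fun n =>
    Nat.rec ⟨∅, by simpa using h⟩ (fun n L => step (e n) L) n
  have hL : Monotone fun n => (L n).1 := monotone_nat_of_le_succ fun n => hs₁ (e n) (L n)
  let C : Set Fml := S ∪ {ψ | ∃ n, ψ ∈ (L n).1}
  have hLC : ∀ n, S ∪ (L n).1 ⊆ C := fun n =>
    Set.union_subset_union_right _ fun ψ hψ => ⟨n, hψ⟩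
  have hC : ¬ Derives T C φ := by
    rintro ⟨Γ, hΓ, hp⟩
    have : ∃ n, ∀ ψ ∈ Γ, ψ ∈ S ∪ ((L n).1 : Set Fml) := by
      clear hp
      induction Γ with
      | nil => exact ⟨0, by simp⟩
      | cons a Γ ih =>
        obtain ⟨n, hn⟩ := ih fun ψ hψ => hΓ ψ (by simp [hψ])
        rcases hΓ a (by simp) with ha | ⟨m, hm⟩
        · exact ⟨n, by simpa using ⟨.inl ha, hn⟩⟩
        · refine ⟨max m n, fun ψ hψ => ?_⟩
          rcases List.mem_cons.1 hψ with rfl | hψ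
          · exact .inr (hL (le_max_left m n) hm)
          · exact (hn ψ hψ).imp id fun h => hL (le_max_right m n) h
    obtain ⟨n, hn⟩ := this
    exact (L n).2 ⟨Γ, hn, hp⟩
  have hmax : ∀ χ, χ ∉ C → Derives T (insert χ C) φ := by
    intro χ hχ
    obtain ⟨n, rfl⟩ := he χ
    rcases hs₂ (e n) (L n) with h | h
    · exact absurd (.inr ⟨n + 1, h⟩) hχ
    · exact h.mono (Set.insert_subset_insert (hLC n))
  have hcl : ∀ χ, Derives T C χ → χ ∈ C := by
    intro χ hχ
    by_contra hn
    exact hC ((hmax χ hn).imp.mp hχ)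
  refine ⟨⟨C, hcl, fun hb => hC (.lift (.botE (.hyp (by simp))) (.hyp hb)), ?_, ?_⟩,
    fun ψ hψ => .inl hψ, fun hφ => hC (.hyp hφ)⟩
  · intro χ ψ h
    by_contra! hn
    exact hC (.or_elim (.hyp h) (hmax χ hn.1) (hmax ψ hn.2))
  · intro ψ hψ
    obtain ⟨n, hn⟩ := he (.ex ψ)
    rcases hs₂ (e n) (L n) with h | h
    · obtain ⟨c, hc⟩ := hs₃ (e n) (L n) ψ hn h
      exact ⟨c, .inr ⟨n + 1, hc⟩⟩
    · refine absurd (h.mono (Set.insert_subset ?_ (hLC n))) hC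
      rwa [hn]

/-- A set S may use up all variables. Doubling every variable leaves the odd ones fresh, at the
price of a renaming between S and the new theory. -/
theorem exists_primeTheory {T S : Set Fml} {φ : Fml} (h : ¬ Derives T S φ) :
    ∃ (w : PrimeTheory T) (f : ℕ → ℕ), (∀ ψ ∈ S, ψ.ren f ∈ w.carrier) ∧ φ.ren f ∉ w.carrier := by
  have hinv : ∀ ψ : Fml, (ψ.ren (fun n => 2 * n)).ren (fun n => n / 2) = ψ := fun ψ => by
    rw [Fml.ren_ren, Fml.ren_congr (g := fun n => n) fun n => by simp, Fml.ren_id]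
  have hfr : ∀ N, ∃ c ≥ N, ∀ ψ ∈ Fml.ren (fun n => 2 * n) '' S, ψ.Fresh c := by
    rintro N
    refine ⟨2 * N + 1, by omega, ?_⟩
    rintro _ ⟨ψ, _, rfl⟩ f g hfg
    rw [Fml.ren_ren, Fml.ren_ren]
    exact Fml.ren_congr (fun n => hfg _ (by omega)) ψ
  have hd : ¬ Derives T (Fml.ren (fun n => 2 * n) '' S) (φ.ren (fun n => 2 * n)) := by
    intro hd
    have := hd.ren (fun n => n / 2)
    rw [hinv, Set.image_image] at this
    simp only [hinv, Set.image_id'] at this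
    exact h this
  obtain ⟨w, hw, hφ⟩ := exists_primeTheory_of_fresh hfr hd
  exact ⟨w, _, fun ψ hψ => hw ⟨ψ, hψ, rfl⟩, hφ⟩

/-! ## Kripke structures -/

/-- A Kripke structure over a category of worlds, with genuine equality in each world. -/
class Kripke (W : Type) where
  Hom : W → W → Type
  D : W → Type
  map : ∀ {v w}, Hom v w → D v → D w
  nonempty : ∀ w, Nonempty (D w)
  idHom : ∀ w, Hom w w
  comp : ∀ {u v w}, Hom u v → Hom v w → Hom u w
  map_id : ∀ {w} (x : D w), map (idHom w) x = x
  map_comp : ∀ {u v w} (h : Hom u v) (k : Hom v w) (x : D u), map (comp h k) x = map k (map h x)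
  Mem : ∀ {w}, D w → D w → Prop
  mem_map : ∀ {v w} (h : Hom v w) {x y : D v}, Mem x y → Mem (map h x) (map h y)

open Kripke (D Hom idHom comp)

section Kripke

variable {W : Type} [Kripke W] {v w : W}

instance : CoeFun (Hom v w) (fun _ => D v → D w) := ⟨Kripke.map⟩

instance : Membership (D w) (D w) := ⟨fun y x => Kripke.Mem x y⟩

/-- Kripke forcing. -/
def Force : Fml → ∀ {w : W}, (ℕ → D w) → Prop
  | .bot, _, _ => False
  | .eq x y, _, σ => σ x = σ y
  | .mem x y, _, σ => σ x ∈ σ y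
  | .and φ ψ, _, σ => Force φ σ ∧ Force ψ σ
  | .or φ ψ, _, σ => Force φ σ ∨ Force ψ σ
  | .imp φ ψ, w, σ => ∀ (w' : W) (h : Hom w w'), Force φ (fun n => h (σ n)) →
      Force ψ (fun n => h (σ n))
  | .all φ, w, σ => ∀ (w' : W) (h : Hom w w') (x : D w'), Force φ (scons x (fun n => h (σ n)))
  | .ex φ, w, σ => ∃ x : D w, Force φ (scons x σ)

end Kripke

/-! ## The canonical model -/

section Canonical

variable {T : Set Fml}

theorem PrimeTheory.of_proves (w : PrimeTheory T) {φ : Fml} (h : Proves T [] φ) : φ ∈ w.carrier :=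
  w.closed _ (.of_proves h)

theorem PrimeTheory.lift (w : PrimeTheory T) {φ ψ : Fml} (h : Proves T [φ] ψ)
    (h₁ : φ ∈ w.carrier) : ψ ∈ w.carrier :=
  w.closed _ (.lift h (.hyp h₁))

theorem PrimeTheory.lift₂ (w : PrimeTheory T) {φ ψ χ : Fml} (h : Proves T [ψ, φ] χ)
    (h₁ : φ ∈ w.carrier) (h₂ : ψ ∈ w.carrier) : χ ∈ w.carrier :=
  w.closed _ (.lift₂ h (.hyp h₁) (.hyp h₂))

/-- Replacing equals in a formula with a distinguished variable. -/
theorem PrimeTheory.subst (w : PrimeTheory T) (φ : Fml) {s t : ℕ} (h : (s =ᶠ t) ∈ w.carrier)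
    (h₁ : φ.inst s ∈ w.carrier) : φ.inst t ∈ w.carrier :=
  w.lift₂ (.eqE (s := s) (φ := φ) (.hyp (by simp)) (.hyp (by simp))) h h₁

/-- Two variables are identified when the theory proves them equal. -/
def PrimeTheory.setoid (w : PrimeTheory T) : Setoid ℕ where
  r x y := (x =ᶠ y) ∈ w.carrier
  iseqv :=
    have symm : ∀ {x y : ℕ}, (x =ᶠ y) ∈ w.carrier → (y =ᶠ x) ∈ w.carrier := fun {x _} h =>
      w.subst (0 =ᶠ (x + 1)) h (w.of_proves (.eqI x))
    { refl := fun x => w.of_proves (.eqI x)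
      symm := symm
      trans := fun {_ _ z} h h' => w.subst (0 =ᶠ (z + 1)) (symm h) h' }

theorem PrimeTheory.mem_congr (w : PrimeTheory T) {x y x' y' : ℕ} (hx : w.setoid x x')
    (hy : w.setoid y y') (h : (x ∈ᶠ y) ∈ w.carrier) : (x' ∈ᶠ y') ∈ w.carrier :=
  w.subst ((x' + 1) ∈ᶠ 0) hy (w.subst (0 ∈ᶠ (y + 1)) hx h)

/-- Inclusions would be too few transitions, since extending a theory with new witnesses may require
renaming its variables first. -/
instance : Kripke (PrimeTheory T) where
  Hom v w := {f : ℕ → ℕ // ∀ φ ∈ v.carrier, φ.ren f ∈ w.carrier}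
  D w := Quotient w.setoid
  map h := Quotient.map h.1 fun _ _ hxy => h.2 _ hxy
  nonempty w := ⟨Quotient.mk _ 0⟩
  idHom w := ⟨fun n => n, fun φ h => by rwa [Fml.ren_id]⟩
  comp h k := ⟨fun n => k.1 (h.1 n), fun φ hφ => by
    rw [← Fml.ren_ren]
    exact k.2 _ (h.2 _ hφ)⟩
  map_id x := by
    induction x using Quotient.inductionOn
    rfl
  map_comp h k x := by
    induction x using Quotient.inductionOn
    rfl
  Mem {w} := Quotient.lift₂ (fun x y => (x ∈ᶠ y) ∈ w.carrier) fun _ _ _ _ hx hy =>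
    propext ⟨w.mem_congr hx hy, w.mem_congr (w.setoid.symm hx) (w.setoid.symm hy)⟩
  mem_map h x y := by
    induction x using Quotient.inductionOn
    induction y using Quotient.inductionOn
    exact fun hxy => h.2 _ hxy

theorem Fml.ren_scons_inst (φ : Fml) (ρ : ℕ → ℕ) (t : ℕ) :
    (φ.ren (scons 0 (fun n => ρ n + 1))).inst t = φ.ren (scons t ρ) := by
  rw [Fml.inst, Fml.ren_ren]
  apply Fml.ren_congr
  rintro (_ | n) <;> rfl

/-- Forcing in the canonical model is membership. -/
theorem force_iff_mem (φ : Fml) (w : PrimeTheory T) (ρ : ℕ → ℕ) :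
    Force φ (w := w) (fun n => Quotient.mk w.setoid (ρ n)) ↔ φ.ren ρ ∈ w.carrier := by
  induction φ generalizing w ρ with
  | bot => exact iff_of_false id w.consistent
  | eq x y => exact ⟨fun h => Quotient.exact h, fun h => Quotient.sound h⟩
  | mem x y => exact Iff.rfl
  | and φ ψ ih₁ ih₂ =>
    simp only [Force, ih₁, ih₂]
    exact ⟨fun h => w.lift₂ (.andI (.hyp (by simp)) (.hyp (by simp))) h.1 h.2,
      fun h => ⟨w.lift (.andE₁ (.hyp (by simp; rfl))) h, w.lift (.andE₂ (.hyp (by simp; rfl))) h⟩⟩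
  | or φ ψ ih₁ ih₂ =>
    simp only [Force, ih₁, ih₂]
    refine ⟨fun h => ?_, fun h => w.prime _ _ h⟩
    rcases h with h | h
    · exact w.lift (.orI₁ (.hyp (by simp))) h
    · exact w.lift (.orI₂ (.hyp (by simp))) h
  | imp φ ψ ih₁ ih₂ =>
    constructor
    · intro h
      by_contra hn
      have hd : ¬ Derives T (insert (φ.ren ρ) w.carrier) (ψ.ren ρ) := fun hd =>
        hn (w.closed _ hd.imp)
      obtain ⟨w', f, hf, hψ⟩ := exists_primeTheory hd
      have := h w' ⟨f, fun χ hχ => hf χ (.inr hχ)⟩ ((ih₁ w' fun n => f (ρ n)).2 (by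
        rw [← Fml.ren_ren]
        exact hf _ (.inl rfl)))
      rw [Fml.ren_ren] at hψ
      exact hψ ((ih₂ w' fun n => f (ρ n)).1 this)
    · intro h w' k hk
      have h₁ := (ih₁ w' fun n => k.1 (ρ n)).1 hk
      have h₂ := k.2 _ h
      refine (ih₂ w' fun n => k.1 (ρ n)).2 ?_
      rw [Fml.ren_ren] at h₂
      exact w'.lift₂ (.impE (.hyp (.tail _ (.head _))) (.hyp (.head _))) h₂ h₁
  | all φ ih =>
    have key : ∀ (w' : PrimeTheory T) (k : Hom w w') (t : ℕ),
        Force φ (w := w') (scons (Quotient.mk w'.setoid t)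
          (fun n => k (Quotient.mk w.setoid (ρ n)))) ↔
        φ.ren (scons t (fun n => k.1 (ρ n))) ∈ w'.carrier := fun w' k t => by
      rw [← ih]
      refine iff_of_eq (congrArg _ (funext ?_))
      rintro (_ | n) <;> rfl
    constructor
    · intro h
      by_contra hn
      have hd : ¬ Derives T (Fml.wk '' w.carrier) (φ.ren (scons 0 (fun n => ρ n + 1))) := fun hd =>
        hn (w.closed _ hd.all)
      obtain ⟨w', f, hf, hψ⟩ := exists_primeTheory hd
      refine hψ ?_
      -- The theory was weakened before it was extended, so the shifted f is a transition and `f 0`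
      -- names the element refuting the body.
      have h₁ := h w' ⟨fun n => f (n + 1), fun χ hχ => ?_⟩ (Quotient.mk _ (f 0))
      · rw [key] at h₁
        rw [Fml.ren_ren]
        refine Eq.mp (congrArg (· ∈ w'.carrier) (Fml.ren_congr ?_ φ)) h₁
        rintro (_ | n) <;> rfl
      · have := hf _ ⟨χ, hχ, rfl⟩
        rwa [Fml.wk, Fml.ren_ren] at this
    · intro h w' k x
      induction x using Quotient.inductionOn with | _ t
      refine (key w' k t).2 ?_
      have := k.2 _ h
      rw [Fml.ren_ren, Fml.ren] at this
      rw [← Fml.ren_scons_inst]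
      exact w'.lift (.allE t (.hyp (by simp))) this
  | ex φ ih =>
    have key : ∀ t : ℕ, Force φ (w := w) (scons (Quotient.mk w.setoid t)
          (fun n => Quotient.mk w.setoid (ρ n))) ↔
        (φ.ren (scons 0 (fun n => ρ n + 1))).inst t ∈ w.carrier := fun t => by
      rw [Fml.ren_scons_inst, ← ih]
      refine iff_of_eq (congrArg _ (funext ?_))
      rintro (_ | n) <;> rfl
    constructor
    · rintro ⟨x, hx⟩
      induction x using Quotient.inductionOn with | _ t
      exact w.lift (.exI t (.hyp (by simp))) ((key t).1 hx)
    · intro h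
      obtain ⟨t, ht⟩ := w.witness _ h
      exact ⟨Quotient.mk _ t, (key t).2 ht⟩

end Canonical

/-- A Kripke structure that forces `T`. -/
class KripkeModel (T : Set Fml) (W : Type) [Kripke W] : Prop where
  force : ∀ φ ∈ T, ∀ (w : W) (σ : ℕ → D w), Force φ σ

instance (T : Set Fml) : KripkeModel T (PrimeTheory T) where
  force φ hφ w σ := by
    obtain ⟨ρ, rfl⟩ : ∃ ρ : ℕ → ℕ, σ = fun n => Quotient.mk w.setoid (ρ n) :=
      ⟨fun n => (σ n).out, by simp⟩
    exact (force_iff_mem φ w ρ).2 (w.of_proves (.thy ρ hφ))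

/-- Completeness of Kripke semantics. -/
theorem proves_of_force {T : Set Fml} {φ : Fml}
    (h : ∀ (W : Type) [Kripke W] [KripkeModel T W] (w : W) (σ : ℕ → D w), Force φ σ) : Proves T [] φ := by
  by_contra hn
  have hd : ¬ Derives T ∅ φ := by
    rintro ⟨Γ, hΓ, hp⟩
    obtain rfl : Γ = [] := List.eq_nil_iff_forall_not_mem.2 fun ψ hψ => hΓ ψ hψ
    exact hn hp
  obtain ⟨w, f, -, hw⟩ := exists_primeTheory hd
  exact hw ((force_iff_mem φ w f).1 (h _ w _))

/-! ## Properties of forcing -/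

section Force

variable {W : Type} [Kripke W] {v w w' : W}

@[simp] theorem scons_zero {α : Type} (a : α) (σ : ℕ → α) : scons a σ 0 = a := rfl

@[simp] theorem scons_succ {α : Type} (a : α) (σ : ℕ → α) (n : ℕ) : scons a σ (n + 1) = σ n := rfl

theorem map_scons (h : Hom v w) (a : D v) (σ : ℕ → D v) :
    (fun n => h (scons a σ n)) = scons (h a) (fun n => h (σ n)) :=
  funext fun n => scons_comp (fun x => h x) a σ n

theorem idHom_apply (x : D w) : (idHom w) x = x := Kripke.map_id x

theorem comp_apply (h : Hom v w) (k : Hom w w') (x : D v) : (comp h k) x = k (h x) :=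
  Kripke.map_comp h k x

theorem mem_map {x y : D v} (h : Hom v w) (hx : x ∈ y) : h x ∈ h y := Kripke.mem_map h hx

theorem force_ren (φ : Fml) (f : ℕ → ℕ) (σ : ℕ → D w) :
    Force (φ.ren f) σ ↔ Force φ (fun n => σ (f n)) := by
  have key : ∀ {u : W} (f : ℕ → ℕ) (σ : ℕ → D u) (x : D u),
      (fun n => scons x σ (scons 0 (fun n => f n + 1) n)) = scons x (fun n => σ (f n)) := by
    intros
    funext n
    cases n <;> rfl
  induction φ generalizing f w with
  | bot | eq | mem => rfl
  | and _ _ ih₁ ih₂ | or _ _ ih₁ ih₂ | imp _ _ ih₁ ih₂ => simp only [Fml.ren, Force, ih₁, ih₂]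
  | all _ ih => simp only [Fml.ren, Force, ih, key f (fun n => Kripke.map _ (σ n))]
  | ex _ ih => simp only [Fml.ren, Force, ih, key]

@[simp] theorem force_bot (σ : ℕ → D w) : Force .bot σ ↔ False := Iff.rfl

@[simp] theorem force_eq (x y : ℕ) (σ : ℕ → D w) : Force (x =ᶠ y) σ ↔ σ x = σ y := Iff.rfl

@[simp] theorem force_mem (x y : ℕ) (σ : ℕ → D w) : Force (x ∈ᶠ y) σ ↔ σ x ∈ σ y := Iff.rfl

@[simp] theorem force_and (φ ψ : Fml) (σ : ℕ → D w) :
    Force (φ ∧ᶠ ψ) σ ↔ Force φ σ ∧ Force ψ σ := Iff.rfl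

@[simp] theorem force_or (φ ψ : Fml) (σ : ℕ → D w) :
    Force (φ ∨ᶠ ψ) σ ↔ Force φ σ ∨ Force ψ σ := Iff.rfl

@[simp] theorem force_ex (φ : Fml) (σ : ℕ → D w) :
    Force (.ex φ) σ ↔ ∃ x : D w, Force φ (scons x σ) := Iff.rfl

@[simp] theorem force_all (φ : Fml) (σ : ℕ → D w) :
    Force (.all φ) σ ↔
      ∀ (w' : W) (h : Hom w w') (x : D w'), Force φ (scons x (fun n => h (σ n))) := Iff.rfl

@[simp] theorem force_imp (φ ψ : Fml) (σ : ℕ → D w) :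
    Force (φ →ᶠ ψ) σ ↔
      ∀ (w' : W) (h : Hom w w'), Force φ (fun n => h (σ n)) → Force ψ (fun n => h (σ n)) := Iff.rfl

@[simp] theorem force_neg (φ : Fml) (σ : ℕ → D w) :
    Force φ.neg σ ↔ ∀ (w' : W) (h : Hom w w'), ¬ Force φ (fun n => h (σ n)) := Iff.rfl

/-- The passage to a second later world is absorbed by composing the two transitions. The next
lemmas do the same for other quantifier prefixes. -/
theorem force_all_imp (φ ψ : Fml) (σ : ℕ → D w) :
    Force (.all (φ →ᶠ ψ)) σ ↔ ∀ (w' : W) (h : Hom w w') (x : D w'),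
      Force φ (scons x (fun n => h (σ n))) → Force ψ (scons x (fun n => h (σ n))) := by
  constructor
  · intro H w' h x
    have := H w' h x w' (idHom w')
    simpa only [idHom_apply] using this
  · intro H w' h x u k
    have := H u (comp h k) (k x)
    simpa only [comp_apply, map_scons] using this

theorem force_all_iff (φ ψ : Fml) (σ : ℕ → D w) :
    Force (.all (φ ↔ᶠ ψ)) σ ↔ ∀ (w' : W) (h : Hom w w') (x : D w'),
      Force φ (scons x (fun n => h (σ n))) ↔ Force ψ (scons x (fun n => h (σ n))) := by
  have h₁ := force_all_imp φ ψ σ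
  have h₂ := force_all_imp ψ φ σ
  refine ⟨fun H w' h x => ⟨h₁.1 (fun w' h x => (H w' h x).1) w' h x,
    h₂.1 (fun w' h x => (H w' h x).2) w' h x⟩, fun H w' h x => ⟨?_, ?_⟩⟩
  · exact h₁.2 (fun w' h x => (H w' h x).1) w' h x
  · exact h₂.2 (fun w' h x => (H w' h x).2) w' h x

theorem force_all_neg (φ : Fml) (σ : ℕ → D w) :
    Force (.all φ.neg) σ ↔ ∀ (w' : W) (h : Hom w w') (x : D w'),
      ¬ Force φ (scons x (fun n => h (σ n))) :=
  force_all_imp φ .bot σ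

theorem force_all_all (φ : Fml) (σ : ℕ → D w) :
    Force (.all (.all φ)) σ ↔ ∀ (w' : W) (h : Hom w w') (x y : D w'),
      Force φ (scons y (scons x (fun n => h (σ n)))) := by
  constructor
  · intro H w' h x y
    have := H w' h x w' (idHom w') y
    simpa only [idHom_apply] using this
  · intro H w' h x u k y
    have := H u (comp h k) (k x) y
    simpa only [comp_apply, map_scons] using this

theorem force_all_all_imp (φ ψ : Fml) (σ : ℕ → D w) :
    Force (.all (.all (φ →ᶠ ψ))) σ ↔ ∀ (w' : W) (h : Hom w w') (x y : D w'),
      Force φ (scons y (scons x (fun n => h (σ n)))) →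
      Force ψ (scons y (scons x (fun n => h (σ n)))) := by
  rw [force_all]
  simp only [force_all_imp, map_scons]
  constructor
  · intro H w' h x y
    have := H w' h x w' (idHom w') y
    simpa only [idHom_apply] using this
  · intro H w' h x u k y
    have := H u (comp h k) (k x) y
    simpa only [comp_apply] using this

theorem force_all_all_all_imp (φ ψ : Fml) (σ : ℕ → D w) :
    Force (.all (.all (.all (φ →ᶠ ψ)))) σ ↔ ∀ (w' : W) (h : Hom w w') (x y z : D w'),
      Force φ (scons z (scons y (scons x (fun n => h (σ n))))) →
      Force ψ (scons z (scons y (scons x (fun n => h (σ n))))) := by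
  rw [force_all]
  simp only [force_all_all_imp, map_scons]
  constructor
  · intro H w' h x y z
    have := H w' h x w' (idHom w') y z
    simpa only [idHom_apply] using this
  · intro H w' h x u k y z
    have := H u (comp h k) (k x) y z
    simpa only [comp_apply] using this

end Force

/-! ## Stratification of the basic formulas -/

section Strat

variable {σ : ℕ → ℕ}

@[simp] theorem stratBy_eq (x y : ℕ) : (x =ᶠ y).StratBy σ ↔ σ x = σ y := Iff.rfl
@[simp] theorem stratBy_mem (x y : ℕ) : (x ∈ᶠ y).StratBy σ ↔ σ y = σ x + 1 := Iff.rfl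
@[simp] theorem stratBy_bot : Fml.bot.StratBy σ := trivial
@[simp] theorem stratBy_and (φ ψ : Fml) :
    (φ ∧ᶠ ψ).StratBy σ ↔ φ.StratBy σ ∧ ψ.StratBy σ := Iff.rfl
@[simp] theorem stratBy_or (φ ψ : Fml) :
    (φ ∨ᶠ ψ).StratBy σ ↔ φ.StratBy σ ∧ ψ.StratBy σ := Iff.rfl
@[simp] theorem stratBy_imp (φ ψ : Fml) :
    (φ →ᶠ ψ).StratBy σ ↔ φ.StratBy σ ∧ ψ.StratBy σ := Iff.rfl
@[simp] theorem stratBy_iff (φ ψ : Fml) :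
    (φ ↔ᶠ ψ).StratBy σ ↔ φ.StratBy σ ∧ ψ.StratBy σ := by
  simp only [Fml.iff, stratBy_and, stratBy_imp]
  tauto
@[simp] theorem stratBy_neg (φ : Fml) : φ.neg.StratBy σ ↔ φ.StratBy σ := by simp [Fml.neg]
@[simp] theorem stratBy_all (φ : Fml) :
    (Fml.all φ).StratBy σ ↔ ∃ k, φ.StratBy (scons k σ) := Iff.rfl
@[simp] theorem stratBy_ex (φ : Fml) :
    (Fml.ex φ).StratBy σ ↔ ∃ k, φ.StratBy (scons k σ) := Iff.rfl

theorem stratBy_ren (φ : Fml) (f : ℕ → ℕ) (σ : ℕ → ℕ) :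
    (φ.ren f).StratBy σ ↔ φ.StratBy (fun n => σ (f n)) := by
  have key : ∀ (f : ℕ → ℕ) (σ : ℕ → ℕ) (x : ℕ),
      (fun n => scons x σ (scons 0 (fun n => f n + 1) n)) = scons x (fun n => σ (f n)) := by
    intros
    funext n
    cases n <;> rfl
  induction φ generalizing f σ with
  | bot | eq | mem => rfl
  | and _ _ ih₁ ih₂ | or _ _ ih₁ ih₂ | imp _ _ ih₁ ih₂ =>
    simp only [Fml.ren, Fml.StratBy, ih₁, ih₂]
  | all _ ih | ex _ ih => simp only [Fml.ren, Fml.StratBy, ih, key]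

@[simp] theorem stratBy_isEmpty (z : ℕ) : (isEmpty z).StratBy σ ↔ ∃ k, σ z = k + 1 := by
  simp [isEmpty]
@[simp] theorem stratBy_inhabited (z : ℕ) : (inhabited z).StratBy σ ↔ ∃ k, σ z = k + 1 := by
  simp [inhabited]
@[simp] theorem stratBy_subset (a b : ℕ) :
    (subset a b).StratBy σ ↔ ∃ k, σ a = k + 1 ∧ σ b = k + 1 := by
  simp [subset]
@[simp] theorem stratBy_isSingleton (z x : ℕ) :
    (isSingleton z x).StratBy σ ↔ σ z = σ x + 1 := by
  simp [isSingleton]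
@[simp] theorem stratBy_isUPair (z x y : ℕ) :
    (isUPair z x y).StratBy σ ↔ σ z = σ x + 1 ∧ σ x = σ y := by
  simp [isUPair]
  grind
@[simp] theorem stratBy_isUnion (z a b : ℕ) :
    (isUnion z a b).StratBy σ ↔ ∃ k, σ z = k + 1 ∧ σ a = k + 1 ∧ σ b = k + 1 := by
  simp [isUnion]
@[simp] theorem stratBy_isAdjoin (z a c : ℕ) :
    (isAdjoin z a c).StratBy σ ↔ σ z = σ c + 1 ∧ σ a = σ c + 1 := by
  simp only [isAdjoin, stratBy_all, stratBy_iff, stratBy_mem, stratBy_or, stratBy_eq, scons_zero,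
    scons_succ]
  grind
@[simp] theorem stratBy_disjoint (a b : ℕ) :
    (disjoint a b).StratBy σ ↔ ∃ k, σ a = k + 1 ∧ σ b = k + 1 := by
  simp [disjoint]
@[simp] theorem stratBy_isPair (z x y : ℕ) :
    (isPair z x y).StratBy σ ↔ σ z = σ x + 2 ∧ σ x = σ y := by
  simp [isPair]
@[simp] theorem stratBy_pairMem (x y f : ℕ) :
    (pairMem x y f).StratBy σ ↔ σ f = σ x + 3 ∧ σ x = σ y := by
  simp [pairMem]
  grind
@[simp] theorem stratBy_isTriple (t x y z : ℕ) :
    (isTriple t x y z).StratBy σ ↔ σ t = σ x + 4 ∧ σ x = σ y ∧ σ x = σ z := by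
  simp [isTriple]
  grind
@[simp] theorem stratBy_tripleMem (x y z t : ℕ) :
    (tripleMem x y z t).StratBy σ ↔ σ t = σ x + 5 ∧ σ x = σ y ∧ σ x = σ z := by
  simp [tripleMem]
  grind
@[simp] theorem stratBy_isUSC (z a : ℕ) :
    (isUSC z a).StratBy σ ↔ ∃ k, σ z = k + 2 ∧ σ a = k + 1 := by
  simp [isUSC]
@[simp] theorem stratBy_isSSC (z a : ℕ) :
    (isSSC z a).StratBy σ ↔ ∃ k, σ z = k + 2 ∧ σ a = k + 1 := by
  simp [isSSC]
@[simp] theorem stratBy_similar (a b : ℕ) :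
    (similar a b).StratBy σ ↔ ∃ k, σ a = k + 1 ∧ σ b = k + 1 := by
  simp [similar, mapsTo, oneToOne, onto]
  exact exists_congr fun k => by tauto
@[simp] theorem stratBy_isZero (z : ℕ) : (isZero z).StratBy σ ↔ ∃ k, σ z = k + 2 := by
  simp [isZero]
  exact ⟨fun ⟨k, hk, h⟩ => ⟨k - 1, by omega⟩, fun ⟨k, hk⟩ => ⟨k + 1, by omega, by omega⟩⟩
@[simp] theorem stratBy_zeroMem (z : ℕ) : (zeroMem z).StratBy σ ↔ ∃ k, σ z = k + 3 := by
  simp [zeroMem]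
@[simp] theorem stratBy_isSucc (s k : ℕ) :
    (isSucc s k).StratBy σ ↔ ∃ j, σ s = j + 2 ∧ σ k = j + 2 := by
  simp [isSucc]
@[simp] theorem stratBy_memF (k : ℕ) : (memF k).StratBy σ ↔ ∃ j, σ k = j + 2 := by
  simp [memF]
@[simp] theorem stratBy_memSF (k : ℕ) : (memSF k).StratBy σ ↔ ∃ j, σ k = j + 2 := by
  simp [memSF]
@[simp] theorem stratBy_isAdd (z x y : ℕ) :
    (isAdd z x y).StratBy σ ↔ ∃ j, σ z = j + 2 ∧ σ x = j + 2 ∧ σ y = j + 2 := by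
  simp [isAdd]
@[simp] theorem stratBy_mulClosed (t : ℕ) : (mulClosed t).StratBy σ ↔ ∃ j, σ t = j + 7 := by
  simp [mulClosed]

end Strat

/-! ## Terms in a Kripke model of INF -/

section Terms

variable {W : Type} [Kripke W] {v w : W}

/-- Inclusion, at all later worlds. -/
def Sub (a b : D w) : Prop := ∀ (w' : W) (h : Hom w w') (x : D w'), x ∈ h a → x ∈ h b

/-- Disjointness, at all later worlds. -/
def Disj (a b : D w) : Prop := ∀ (w' : W) (h : Hom w w') (x : D w'), ¬ (x ∈ h a ∧ x ∈ h b)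

/-- Non-membership, at all later worlds. -/
def NMem (x a : D w) : Prop := ∀ (w' : W) (h : Hom w w'), ¬ h x ∈ h a

theorem Sub.map {a b : D v} (H : Sub a b) (h : Hom v w) : Sub (h a) (h b) := fun w' k x => by
  simpa only [comp_apply] using H w' (comp h k) x

theorem Disj.map {a b : D v} (H : Disj a b) (h : Hom v w) : Disj (h a) (h b) := fun w' k x => by
  simpa only [comp_apply] using H w' (comp h k) x

theorem NMem.map {a b : D v} (H : NMem a b) (h : Hom v w) : NMem (h a) (h b) := fun w' k => by
  simpa only [comp_apply] using H w' (comp h k)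

theorem Sub.mem {a b : D w} (H : Sub a b) {x : D w} : x ∈ a → x ∈ b := by
  simpa only [idHom_apply] using H w (idHom w) x

theorem NMem.not_mem {x a : D w} (H : NMem x a) (hx : x ∈ a) : False := by
  have := H w (idHom w)
  simp only [idHom_apply] at this
  exact this hx

theorem NMem.of_sub {x a b : D w} (H : NMem x b) (hs : Sub a b) : NMem x a :=
  fun w' h hx => H w' h (hs w' h _ hx)

@[simp] theorem force_subset (a b : ℕ) (σ : ℕ → D w) :
    Force (subset a b) σ ↔ Sub (σ a) (σ b) := by
  rw [subset, force_all_imp]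
  rfl

@[simp] theorem force_disjoint (a b : ℕ) (σ : ℕ → D w) :
    Force (disjoint a b) σ ↔ Disj (σ a) (σ b) := by
  rw [disjoint, force_all_neg]
  rfl

@[simp] theorem force_inhabited (a : ℕ) (σ : ℕ → D w) :
    Force (inhabited a) σ ↔ ∃ u, u ∈ σ a := Iff.rfl

theorem force_not_mem (x a : ℕ) (σ : ℕ → D w) :
    Force (x ∈ᶠ a).neg σ ↔ NMem (σ x) (σ a) := Iff.rfl

variable [KripkeModel theory W]

theorem ext_hom {x y : D w} (H : ∀ (w' : W) (h : Hom w w') (z : D w'), z ∈ h x ↔ z ∈ h y) :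
    x = y := by
  have h₁ : Force extensionality (fun _ => x) := KripkeModel.force (T := theory) _ (.inl rfl) w _
  have h₂ := (force_all_all _ _).1 h₁ w (idHom w) x y w (idHom w)
  have h₃ := h₂ ((force_all_iff _ _ _).2 fun w' h z => by simpa [idHom_apply] using H w' h z)
  simpa [idHom_apply] using h₃

theorem exists_compr (φ : Fml) (hφ : ∃ τ, φ.StratBy τ) (σ : ℕ → D w) :
    ∃ y : D w, ∀ (w' : W) (h : Hom w w') (x : D w'),
      x ∈ h y ↔ Force φ (scons x (fun n => h (σ n))) := by
  obtain ⟨y, hy⟩ : Force (comprehension φ) σ :=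
    KripkeModel.force (T := theory) _ (.inr ⟨φ, hφ, rfl⟩) w _
  refine ⟨y, fun w' h x => ?_⟩
  have := (force_all_iff _ _ _).1 hy w' h x
  rw [force_ren] at this
  refine this.trans (iff_of_eq (congrArg _ (funext ?_)))
  rintro (_ | n) <;> rfl

/-- The set of all `x` such that `φ`, where `x` is the variable `0` of `φ` and the other
variables have the values `σ`. -/
noncomputable def compr (φ : Fml) (hφ : ∃ τ, φ.StratBy τ) (σ : ℕ → D w) : D w :=
  (exists_compr φ hφ σ).choose

theorem mem_map_compr {φ : Fml} {hφ : ∃ τ, φ.StratBy τ} {σ : ℕ → D v} (h : Hom v w) {x : D w} :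
    x ∈ h (compr φ hφ σ) ↔ Force φ (scons x (fun n => h (σ n))) :=
  (exists_compr φ hφ σ).choose_spec w h x

theorem mem_compr {φ : Fml} {hφ : ∃ τ, φ.StratBy τ} {σ : ℕ → D w} {x : D w} :
    x ∈ compr φ hφ σ ↔ Force φ (scons x σ) := by
  simpa only [idHom_apply] using mem_map_compr (hφ := hφ) (σ := σ) (idHom w) (x := x)

/-- Both sides have the same members at all later worlds, so extensionality overrides the arbitrary
choice in `compr`. -/
theorem map_compr {φ : Fml} {hφ : ∃ τ, φ.StratBy τ} {σ : ℕ → D v} (h : Hom v w) :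
    h (compr φ hφ σ) = compr φ hφ (fun n => h (σ n)) :=
  ext_hom fun w' k z => by
    rw [← comp_apply, mem_map_compr, mem_map_compr]
    simp only [comp_apply]

theorem Sub.antisymm {a b : D w} (h₁ : Sub a b) (h₂ : Sub b a) : a = b :=
  ext_hom fun w' h x => ⟨h₁ w' h x, h₂ w' h x⟩

theorem eq_iff_forall_mem {x y : D w} :
    x = y ↔ ∀ (w' : W) (h : Hom w w') (z : D w'), z ∈ h x ↔ z ∈ h y :=
  ⟨fun H _ _ _ => by rw [H], ext_hom⟩

/-! ### The empty set, singletons, pairs, unions -/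

/-- `Λ`. -/
noncomputable def emp : D w :=
  compr .bot ⟨fun _ => 0, trivial⟩ (fun _ => Classical.choice (Kripke.nonempty w))

/-- `{x}`. -/
noncomputable def sing (x : D w) : D w := compr (0 =ᶠ 1) ⟨fun _ => 0, by simp⟩ (fun _ => x)

/-- `{x, y}`. -/
noncomputable def upair (x y : D w) : D w :=
  compr (0 =ᶠ 1 ∨ᶠ 0 =ᶠ 2) ⟨fun _ => 0, by simp⟩ (scons x fun _ => y)

/-- `a ∪ b`. -/
noncomputable def union (a b : D w) : D w :=
  compr (0 ∈ᶠ 1 ∨ᶠ 0 ∈ᶠ 2) ⟨scons 0 fun _ => 1, by simp⟩ (scons a fun _ => b)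

/-- `a ∪ {c}`. -/
noncomputable def adj (a c : D w) : D w :=
  compr (0 ∈ᶠ 1 ∨ᶠ 0 =ᶠ 2) ⟨scons 0 (scons 1 fun _ => 0), by simp⟩ (scons a fun _ => c)

/-- `⟨x, y⟩`. -/
noncomputable def pair (x y : D w) : D w := upair (sing x) (upair x y)

/-- `⟨x, y, z⟩`. -/
noncomputable def triple (x y z : D w) : D w := pair (pair x y) (sing (sing z))

@[simp] theorem not_mem_emp (x : D w) : ¬ x ∈ (emp : D w) := by simp [emp, mem_compr]

@[simp] theorem map_emp (h : Hom v w) : h emp = emp :=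
  ext_hom fun w' k x => by
    rw [← comp_apply]
    simp [emp, mem_map_compr]

@[simp] theorem mem_sing {u x : D w} : u ∈ sing x ↔ u = x := by simp [sing, mem_compr]

@[simp] theorem map_sing (h : Hom v w) (x : D v) : h (sing x) = sing (h x) := by
  simp only [sing, map_compr]

@[simp] theorem mem_upair {u x y : D w} : u ∈ upair x y ↔ u = x ∨ u = y := by
  simp [upair, mem_compr]

@[simp] theorem map_upair (h : Hom v w) (x y : D v) : h (upair x y) = upair (h x) (h y) := by
  simp only [upair, map_compr, map_scons]

@[simp] theorem mem_union {u a b : D w} : u ∈ union a b ↔ u ∈ a ∨ u ∈ b := by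
  simp [union, mem_compr]

@[simp] theorem map_union (h : Hom v w) (x y : D v) : h (union x y) = union (h x) (h y) := by
  simp only [union, map_compr, map_scons]

@[simp] theorem mem_adj {u a c : D w} : u ∈ adj a c ↔ u ∈ a ∨ u = c := by
  simp [adj, mem_compr]

@[simp] theorem map_adj (h : Hom v w) (x y : D v) : h (adj x y) = adj (h x) (h y) := by
  simp only [adj, map_compr, map_scons]

@[simp] theorem map_pair (h : Hom v w) (x y : D v) : h (pair x y) = pair (h x) (h y) := by
  simp [pair]

@[simp] theorem map_triple (h : Hom v w) (x y z : D v) :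
    h (triple x y z) = triple (h x) (h y) (h z) := by
  simp [triple]

@[simp] theorem sing_inj {x y : D w} : sing x = sing y ↔ x = y := by
  refine ⟨fun h => ?_, congrArg _⟩
  rw [← mem_sing, ← h, mem_sing]

theorem sing_eq_upair {x y z : D w} (h : sing x = upair y z) : x = y ∧ x = z := by
  have h₁ : y ∈ sing x := by simp [h]
  have h₂ : z ∈ sing x := by simp [h]
  exact ⟨(mem_sing.1 h₁).symm, (mem_sing.1 h₂).symm⟩

@[simp] theorem pair_inj {x y x' y' : D w} : pair x y = pair x' y' ↔ x = x' ∧ y = y' := by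
  refine ⟨fun h => ?_, fun ⟨h₁, h₂⟩ => by rw [h₁, h₂]⟩
  have h₁ : sing x ∈ pair x' y' := by
    rw [← h]
    simp [pair]
  have hx : x = x' := by
    rcases mem_upair.1 h₁ with h₁ | h₁
    · exact sing_inj.1 h₁
    · exact (sing_eq_upair h₁).1
  subst hx
  refine ⟨rfl, ?_⟩
  have h₂ : upair x y ∈ pair x y' := by
    rw [← h]
    simp [pair]
  have h₃ : upair x y' ∈ pair x y := by
    rw [h]
    simp [pair]
  have key : ∀ {a b : D w}, upair x a ∈ pair x b → a = x ∨ a = b := by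
    intro a b hab
    have ha : a ∈ upair x a := by simp
    rcases mem_upair.1 hab with h | h
    · exact .inl (sing_eq_upair h.symm).2.symm
    · simpa [h] using ha
  rcases key h₂ with h₂ | h₂
  · rcases key h₃ with h₃ | h₃
    exacts [h₂.trans h₃.symm, h₃.symm]
  · exact h₂

@[simp] theorem triple_inj {x y z x' y' z' : D w} :
    triple x y z = triple x' y' z' ↔ x = x' ∧ y = y' ∧ z = z' := by
  simp [triple, and_assoc]

@[simp] theorem force_isEmpty (z : ℕ) (σ : ℕ → D w) : Force (isEmpty z) σ ↔ σ z = emp := by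
  rw [isEmpty, force_all_neg, eq_iff_forall_mem]
  simp

@[simp] theorem force_isSingleton (z x : ℕ) (σ : ℕ → D w) :
    Force (isSingleton z x) σ ↔ σ z = sing (σ x) := by
  rw [isSingleton, force_all_iff, eq_iff_forall_mem]
  simp

@[simp] theorem force_isUPair (z x y : ℕ) (σ : ℕ → D w) :
    Force (isUPair z x y) σ ↔ σ z = upair (σ x) (σ y) := by
  rw [isUPair, force_all_iff, eq_iff_forall_mem]
  simp

@[simp] theorem force_isUnion (z x y : ℕ) (σ : ℕ → D w) :
    Force (isUnion z x y) σ ↔ σ z = union (σ x) (σ y) := by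
  rw [isUnion, force_all_iff, eq_iff_forall_mem]
  simp

@[simp] theorem force_isAdjoin (z x y : ℕ) (σ : ℕ → D w) :
    Force (isAdjoin z x y) σ ↔ σ z = adj (σ x) (σ y) := by
  rw [isAdjoin, force_all_iff, eq_iff_forall_mem]
  simp

@[simp] theorem force_isPair (z x y : ℕ) (σ : ℕ → D w) :
    Force (isPair z x y) σ ↔ σ z = pair (σ x) (σ y) := by
  rw [isPair, force_all_iff, eq_iff_forall_mem]
  simp [pair]

@[simp] theorem force_pairMem (x y f : ℕ) (σ : ℕ → D w) :
    Force (pairMem x y f) σ ↔ pair (σ x) (σ y) ∈ σ f := by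
  simp [pairMem]

@[simp] theorem force_isTriple (t x y z : ℕ) (σ : ℕ → D w) :
    Force (isTriple t x y z) σ ↔ σ t = triple (σ x) (σ y) (σ z) := by
  simp [isTriple, triple]

@[simp] theorem force_tripleMem (x y z f : ℕ) (σ : ℕ → D w) :
    Force (tripleMem x y z f) σ ↔ triple (σ x) (σ y) (σ z) ∈ σ f := by
  simp [tripleMem]

/-! ### Similarity -/

/-- `f` is a bijection from `a` to `b`, at all later worlds. -/
structure IsBij (f a b : D w) : Prop where
  exists_value : ∀ (w' : W) (h : Hom w w') (x : D w'), x ∈ h a → ∃ y ∈ h b, pair x y ∈ h f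
  unique : ∀ (w' : W) (h : Hom w w') (x y y' : D w'), x ∈ h a → y ∈ h b → y' ∈ h b →
    pair x y ∈ h f → pair x y' ∈ h f → y = y'
  dom : ∀ (w' : W) (h : Hom w w') (x y : D w'), y ∈ h b → pair x y ∈ h f → x ∈ h a
  inj : ∀ (w' : W) (h : Hom w w') (x x' y : D w'), x ∈ h a → x' ∈ h a → y ∈ h b →
    pair x y ∈ h f → pair x' y ∈ h f → x = x'
  onto : ∀ (w' : W) (h : Hom w w') (y : D w'), y ∈ h b → ∃ x ∈ h a, pair x y ∈ h f

/-- Similarity `a ∼ b`. -/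
def Sim (a b : D w) : Prop := ∃ f, IsBij f a b

@[simp] theorem force_similar (a b : ℕ) (σ : ℕ → D w) :
    Force (similar a b) σ ↔ Sim (σ a) (σ b) := by
  refine exists_congr fun f => ?_
  simp only [force_and, force_ex, oneToOne, force_all_all, mapsTo, onto, force_all_imp]
  simp only [force_imp, force_mem, force_and, force_pairMem, force_eq,
    scons_zero, scons_succ]
  constructor
  · rintro ⟨h₁, ⟨h₂, h₃⟩, h₄⟩
    refine ⟨fun w' h x hx => ?_, fun w' h x y y' hx hy hy' hp hp' => ?_,
      fun w' h x y hy hp => ?_, fun w' h x x' y hx hx' hy hp hp' => ?_, h₄⟩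
    · obtain ⟨y, hy, hp, -⟩ := h₁ w' h x hx
      exact ⟨y, hy, hp⟩
    · obtain ⟨z, -, -, hz⟩ := h₁ w' h x hx
      have := hz w' (idHom w')
      simp only [idHom_apply] at this
      rw [this y ⟨hy, hp⟩, this y' ⟨hy', hp'⟩]
    · have := h₂ w' h x y w' (idHom w')
      simp only [idHom_apply] at this
      exact this ⟨hy, hp⟩
    · have := h₃ w' h x x' w' (idHom w') y
      simp only [idHom_apply] at this
      exact this ⟨hx, hx', hy, hp, hp'⟩
  · rintro ⟨h₁, h₂, h₃, h₄, h₅⟩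
    refine ⟨fun w' h x hx => ?_, ⟨fun w' h x y w₂ k ⟨hy, hp⟩ => ?_,
      fun w' h x x' w₂ k y ⟨hx, hx', hy, hp, hp'⟩ => ?_⟩, h₅⟩
    · obtain ⟨y, hy, hp⟩ := h₁ w' h x hx
      refine ⟨y, hy, hp, fun w₂ k z ⟨hz, hpz⟩ => ?_⟩
      have := h₂ w₂ (comp h k) (k x) z (k y)
      simp only [comp_apply] at this
      refine this (mem_map k hx) hz (mem_map k hy) hpz ?_
      have := mem_map k hp
      rwa [map_pair] at this
    · have := h₃ w₂ (comp h k) (k x) (k y)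
      simp only [comp_apply] at this
      exact this hy hp
    · have := h₄ w₂ (comp h k) (k x) (k x') y
      simp only [comp_apply] at this
      exact this hx hx' hy hp hp'

/-- The graph of a stratified relation between objects of the same type. -/
theorem exists_graph (φ : Fml) (τ : ℕ → ℕ) (hφ : φ.StratBy τ) (hτ : τ 0 = τ 1) (σ : ℕ → D w) :
    ∃ f : D w, ∀ (w' : W) (h : Hom w w') (x y : D w'),
      pair x y ∈ h f ↔ Force φ (scons y (scons x (fun n => h (σ n)))) := by
  -- The two coordinates stay 0 and 1; the parameters make room for the pair itself, variable 2,
  -- whose index is two above theirs.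
  let g : ℕ → ℕ := scons 0 (scons 1 fun n => n + 3)
  have hs : ∃ τ, (Fml.ex (.ex (isPair 2 1 0 ∧ᶠ φ.ren g))).StratBy τ := by
    refine ⟨scons (τ 0 + 2) fun n => τ (n + 2), τ 0, τ 0, by simp, ?_⟩
    rw [stratBy_ren]
    refine Eq.mp (congrArg (Fml.StratBy · φ) (funext ?_)) hφ
    rintro (_ | _ | n)
    exacts [rfl, hτ.symm, rfl]
  refine ⟨compr _ hs σ, fun w' h x y => ?_⟩
  have key : ∀ a b : D w', (fun n => scons b (scons a (scons (pair x y) fun n => h (σ n))) (g n)) =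
      scons b (scons a fun n => h (σ n)) := by
    intro a b
    funext n
    rcases n with _ | _ | n <;> rfl
  simp only [mem_map_compr, force_ex, force_and, force_isPair, force_ren, key]
  simp only [scons_zero, scons_succ, pair_inj]
  exact ⟨fun ⟨_, _, ⟨ha, hb⟩, h⟩ => ha ▸ hb ▸ h, fun h => ⟨x, y, ⟨rfl, rfl⟩, h⟩⟩

/-! ### The set operations of the theory of cardinals -/

/-- `USC(a)`. -/
noncomputable def usc (a : D w) : D w :=
  compr (.ex (0 ∈ᶠ 2 ∧ᶠ isSingleton 1 0)) ⟨fun _ => 1, by simp⟩ (fun _ => a)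

/-- `SSC(a)`. -/
noncomputable def ssc (a : D w) : D w :=
  compr (subset 0 1 ∧ᶠ .all (0 ∈ᶠ 2 ↔ᶠ 0 ∈ᶠ 1 ∨ᶠ (0 ∈ᶠ 2 ∧ᶠ (0 ∈ᶠ 1).neg)))
    ⟨fun _ => 1, by simp⟩ (fun _ => a)

/-- Frege zero. -/
noncomputable def zero : D w := sing emp

/-- `κ⁺`. -/
noncomputable def succ (k : D w) : D w :=
  compr (.ex (.ex (1 ∈ᶠ 3 ∧ᶠ (0 ∈ᶠ 1).neg ∧ᶠ isAdjoin 2 1 0)))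
    ⟨scons 1 fun _ => 2, by simp⟩ (fun _ => k)

/-- `x + y`. -/
noncomputable def add (x y : D w) : D w :=
  compr (.ex (.ex (1 ∈ᶠ 3 ∧ᶠ 0 ∈ᶠ 4 ∧ᶠ disjoint 1 0 ∧ᶠ isUnion 2 1 0)))
    ⟨scons 1 fun _ => 2, by simp⟩ (scons x fun _ => y)

/-- `2 ^ m`. -/
noncomputable def exp (m : D w) : D w :=
  compr (.ex (.ex (isUSC 0 1 ∧ᶠ 0 ∈ᶠ 3) ∧ᶠ .ex (isSSC 0 1 ∧ᶠ similar 2 0)))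
    ⟨scons 2 fun _ => 3, by simp⟩ (fun _ => m)

@[simp] theorem mem_usc {u a : D w} : u ∈ usc a ↔ ∃ x ∈ a, u = sing x := by
  simp [usc, mem_compr]

@[simp] theorem map_usc (h : Hom v w) (a : D v) : h (usc a) = usc (h a) := by
  simp only [usc, map_compr]

theorem mem_ssc {u a : D w} : u ∈ ssc a ↔ Sub u a ∧
    ∀ (w' : W) (h : Hom w w') (x : D w'), x ∈ h a → x ∈ h u ∨ NMem x (h u) := by
  simp only [ssc, mem_compr, force_and, force_subset, force_all_iff, force_or, force_not_mem,
    force_mem, scons_zero, scons_succ]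
  refine and_congr_right fun hs => ⟨fun H w' h x hx => ?_, fun H w' h x => ⟨fun hx => ?_, ?_⟩⟩
  · exact ((H w' h x).1 hx).imp id And.right
  · exact (H w' h x hx).imp id fun h => ⟨hx, h⟩
  · rintro (hx | hx)
    exacts [hs w' h x hx, hx.1]

@[simp] theorem map_ssc (h : Hom v w) (a : D v) : h (ssc a) = ssc (h a) := by
  simp only [ssc, map_compr]

@[simp] theorem mem_zero {u : D w} : u ∈ (zero : D w) ↔ u = emp := by simp [zero]

@[simp] theorem map_zero (h : Hom v w) : h zero = zero := by simp [zero]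

theorem mem_succ {u k : D w} : u ∈ succ k ↔ ∃ z c, z ∈ k ∧ NMem c z ∧ u = adj z c := by
  simp only [succ, mem_compr, force_ex, force_and, force_not_mem, force_isAdjoin, force_mem,
    scons_zero, scons_succ]

@[simp] theorem map_succ (h : Hom v w) (k : D v) : h (succ k) = succ (h k) := by
  simp only [succ, map_compr]

theorem mem_add {u x y : D w} :
    u ∈ add x y ↔ ∃ a b, a ∈ x ∧ b ∈ y ∧ Disj a b ∧ u = union a b := by
  simp [add, mem_compr]

@[simp] theorem map_add (h : Hom v w) (x y : D v) : h (add x y) = add (h x) (h y) := by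
  simp only [add, map_compr, map_scons]

@[simp] theorem force_isUSC (z a : ℕ) (σ : ℕ → D w) :
    Force (isUSC z a) σ ↔ σ z = usc (σ a) := by
  rw [isUSC, force_all_iff, eq_iff_forall_mem]
  simp

@[simp] theorem force_isSSC (z a : ℕ) (σ : ℕ → D w) :
    Force (isSSC z a) σ ↔ σ z = ssc (σ a) := by
  rw [isSSC, force_all_iff, eq_iff_forall_mem]
  simp only [ssc, mem_map_compr]
  exact Iff.rfl

@[simp] theorem force_isZero (z : ℕ) (σ : ℕ → D w) : Force (isZero z) σ ↔ σ z = zero := by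
  rw [isZero, force_all_iff, eq_iff_forall_mem]
  simp

@[simp] theorem force_isSucc (z a : ℕ) (σ : ℕ → D w) :
    Force (isSucc z a) σ ↔ σ z = succ (σ a) := by
  rw [isSucc, force_all_iff, eq_iff_forall_mem]
  simp [mem_succ, NMem]

@[simp] theorem force_isAdd (z x y : ℕ) (σ : ℕ → D w) :
    Force (isAdd z x y) σ ↔ σ z = add (σ x) (σ y) := by
  rw [isAdd, force_all_iff, eq_iff_forall_mem]
  simp [mem_add]

theorem mem_exp {u m : D w} : u ∈ exp m ↔ ∃ a, usc a ∈ m ∧ Sim u (ssc a) := by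
  simp [exp, mem_compr]

@[simp] theorem map_exp (h : Hom v w) (m : D v) : h (exp m) = exp (h m) := by
  simp only [exp, map_compr]

@[simp] theorem force_isExp (e m : ℕ) (σ : ℕ → D w) :
    Force (isExp e m) σ ↔ σ e = exp (σ m) := by
  rw [isExp, force_all_iff, eq_iff_forall_mem]
  simp [mem_exp]

/-! ### Finite cardinals and multiplication -/

/-- `𝔽`-closed sets. -/
def FClosed (t : D w) : Prop := zero ∈ t ∧ ∀ (w' : W) (h : Hom w w') (k : D w'),
  k ∈ h t → (∃ u, u ∈ succ k) → succ k ∈ h t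

/-- `SF`-closed sets. -/
def SFClosed (t : D w) : Prop := zero ∈ t ∧ ∀ (w' : W) (h : Hom w w') (k : D w'),
  k ∈ h t → succ k ∈ h t

/-- `k ∈ 𝔽`. -/
def InF (k : D w) : Prop := ∀ (w' : W) (h : Hom w w') (t : D w'), FClosed t → h k ∈ t

/-- `k ∈ SF`. -/
def InSF (k : D w) : Prop := ∀ (w' : W) (h : Hom w w') (t : D w'), SFClosed t → h k ∈ t

theorem InF.map {k : D v} (H : InF k) (h : Hom v w) : InF (h k) := fun w' l t => by
  simpa only [comp_apply] using H w' (comp h l) t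

theorem InSF.map {k : D v} (H : InSF k) (h : Hom v w) : InSF (h k) := fun w' l t => by
  simpa only [comp_apply] using H w' (comp h l) t

theorem InF.inSF {k : D w} (H : InF k) : InSF k := fun w' h t ht =>
  H w' h t ⟨ht.1, fun u l k hk _ => ht.2 u l k hk⟩

theorem InF.mem {k t : D w} (H : InF k) (ht : FClosed t) : k ∈ t := by
  simpa only [idHom_apply] using H w (idHom w) t ht

theorem InSF.mem {k t : D w} (H : InSF k) (ht : SFClosed t) : k ∈ t := by
  simpa only [idHom_apply] using H w (idHom w) t ht

@[simp] theorem force_zeroMem (t : ℕ) (σ : ℕ → D w) : Force (zeroMem t) σ ↔ zero ∈ σ t := by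
  simp [zeroMem]

@[simp] theorem force_memF (k : ℕ) (σ : ℕ → D w) : Force (memF k) σ ↔ InF (σ k) := by
  rw [memF, force_all_imp]
  refine forall_congr' fun w' => forall_congr' fun h => forall_congr' fun t =>
    imp_congr (and_congr (by simp) ?_) (by simp)
  rw [force_all_all]
  simp only [force_imp, force_and, force_mem, force_isSucc, force_inhabited, scons_zero,
    scons_succ]
  constructor
  · intro H w₂ l k hk hi
    have := H w₂ l k (succ k) w₂ (idHom w₂)
    simp only [idHom_apply] at this
    exact this ⟨hk, trivial, hi⟩
  · rintro H w₂ l k s w₃ j ⟨hk, hs, hi⟩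
    have := H w₃ (comp l j) (j k)
    simp only [comp_apply] at this
    rw [hs] at hi ⊢
    exact this hk hi

@[simp] theorem force_memSF (k : ℕ) (σ : ℕ → D w) : Force (memSF k) σ ↔ InSF (σ k) := by
  rw [memSF, force_all_imp]
  refine forall_congr' fun w' => forall_congr' fun h => forall_congr' fun t =>
    imp_congr (and_congr (by simp) ?_) (by simp)
  rw [force_all_all]
  simp only [force_imp, force_and, force_mem, force_isSucc, scons_zero, scons_succ]
  constructor
  · intro H w₂ l k hk
    have := H w₂ l k (succ k) w₂ (idHom w₂)
    simp only [idHom_apply] at this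
    exact this ⟨hk, trivial⟩
  · rintro H w₂ l k s w₃ j ⟨hk, hs⟩
    have := H w₃ (comp l j) (j k)
    simp only [comp_apply] at this
    rw [hs]
    exact this hk

/-- The closure conditions that define multiplication. -/
structure MulClosed (t : D w) : Prop where
  zero_right : ∀ (w' : W) (h : Hom w w') (x : D w'), InSF x → triple x zero zero ∈ h t
  zero_left : ∀ (w' : W) (h : Hom w w') (x : D w'), InSF x → triple zero x zero ∈ h t
  succ_right : ∀ (w' : W) (h : Hom w w') (x y z : D w'), triple x y z ∈ h t →
    triple x (succ y) (add z x) ∈ h t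

@[simp] theorem force_mulClosed (t : ℕ) (σ : ℕ → D w) :
    Force (mulClosed t) σ ↔ MulClosed (σ t) := by
  simp only [mulClosed, force_all, force_imp, force_and, force_memSF, force_isZero,
    force_tripleMem, force_isSucc, force_isAdd, scons_zero, scons_succ]
  constructor
  · rintro ⟨h₁, h₂, h₃⟩
    refine ⟨fun w' h x hx => ?_, fun w' h x hx => ?_, fun w' h x y z hz => ?_⟩
    · have := h₁ w' h x w' (idHom w') zero w' (idHom w')
      simp only [idHom_apply] at this
      exact this ⟨hx, trivial⟩
    · have := h₂ w' h x w' (idHom w') zero w' (idHom w')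
      simp only [idHom_apply] at this
      exact this ⟨hx, trivial⟩
    · have := h₃ w' h x w' (idHom w') y w' (idHom w') z w' (idHom w') (succ y) w' (idHom w')
        (add z x) w' (idHom w')
      simp only [idHom_apply] at this
      exact this ⟨hz, trivial, trivial⟩
  · rintro ⟨h₁, h₂, h₃⟩
    refine ⟨?_, ?_, ?_⟩
    · rintro w₁ k₁ x w₂ k₂ z w₃ k₃ ⟨hx, hz⟩
      have := h₁ w₃ (comp k₁ (comp k₂ k₃)) _ hx
      rw [hz]
      simpa only [comp_apply] using this
    · rintro w₁ k₁ x w₂ k₂ z w₃ k₃ ⟨hx, hz⟩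
      have := h₂ w₃ (comp k₁ (comp k₂ k₃)) _ hx
      rw [hz]
      simpa only [comp_apply] using this
    · rintro w₁ k₁ x w₂ k₂ y w₃ k₃ z w₄ k₄ y' w₅ k₅ z' w₆ k₆ ⟨h, hy, hz⟩
      rw [hy, hz]
      have := h₃ w₆ (comp k₁ (comp k₂ (comp k₃ (comp k₄ (comp k₅ k₆)))))
        (k₆ (k₅ (k₄ (k₃ (k₂ x))))) (k₆ (k₅ (k₄ (k₃ y)))) (k₆ (k₅ (k₄ z)))
      simp only [comp_apply] at this
      exact this h

/-- `⟨x, y, z⟩ ∈ 𝔾`. -/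
def InG (x y z : D w) : Prop :=
  ∀ (w' : W) (h : Hom w w') (t : D w'), MulClosed t → triple (h x) (h y) (h z) ∈ t

theorem InG.mem {x y z t : D w} (H : InG x y z) (ht : MulClosed t) : triple x y z ∈ t := by
  simpa only [idHom_apply] using H w (idHom w) t ht

@[simp] theorem force_memG (x y z : ℕ) (σ : ℕ → D w) :
    Force (memG x y z) σ ↔ InG (σ x) (σ y) (σ z) := by
  rw [memG, force_all_imp]
  simp [InG]

/-- `x · y`. -/
noncomputable def mul (x y : D w) : D w :=
  compr (.ex (memG 2 3 0 ∧ᶠ 1 ∈ᶠ 0)) ⟨scons 1 fun _ => 2, by simp [memG]⟩ (scons x fun _ => y)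

theorem mem_mul {u x y : D w} : u ∈ mul x y ↔ ∃ z, InG x y z ∧ u ∈ z := by
  simp [mul, mem_compr]

@[simp] theorem map_mul (h : Hom v w) (x y : D v) : h (mul x y) = mul (h x) (h y) := by
  simp only [mul, map_compr, map_scons]

@[simp] theorem force_isMul (m x y : ℕ) (σ : ℕ → D w) :
    Force (isMul m x y) σ ↔ σ m = mul (σ x) (σ y) := by
  rw [isMul, force_all_iff, eq_iff_forall_mem]
  simp [mem_mul]

end Terms

/-! ### Similarity, finite cardinals, addition and separable subsets in a model -/

section Arithmetic

variable {W : Type} [Kripke W] [KripkeModel theory W] {v w : W}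

theorem eq_emp {a : D w} (H : ∀ (w' : W) (h : Hom w w') (x : D w'), ¬ x ∈ h a) : a = emp :=
  ext_hom fun w' h x => by simpa using H w' h x

theorem nmem_emp (x : D w) : NMem x emp := fun w' h => by simp

theorem disj_emp (x : D w) : Disj x emp := fun w' h => by simp

theorem union_emp (a : D w) : union a emp = a := ext_hom fun w' h x => by simp

theorem union_adj (a z c : D w) : union a (adj z c) = adj (union a z) c :=
  ext_hom fun w' h x => by simp [or_assoc]

theorem union_right_cancel {a b c : D w} (ha : Disj a c) (hb : Disj b c)
    (h : union a c = union b c) : a = b := by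
  have key : ∀ {a b : D w}, Disj a c → union a c = union b c → Sub a b := by
    intro a b ha h w' k x hx
    have h₁ : x ∈ k (union a c) := by simp [hx]
    rw [h] at h₁
    simp only [map_union, mem_union] at h₁
    exact h₁.resolve_right fun hc => ha w' k x ⟨hx, hc⟩
  exact (key ha h).antisymm (key hb h.symm)

/-! ### Similarity -/

/-- The old bijection is extended by the pair ⟨c, c'⟩. It is first cut down to z × z', because a
bijection may contain stray pairs. -/
theorem Sim.adj {z z' c c' : D w} (H : Sim z z') (hc : NMem c z) (hc' : NMem c' z') :
    Sim (adj z c) (adj z' c') := by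
  obtain ⟨f, he, hu, hd, hi, ho⟩ := H
  obtain ⟨g, hg⟩ := exists_graph ((1 ∈ᶠ 2 ∧ᶠ 0 ∈ᶠ 3 ∧ᶠ pairMem 1 0 4) ∨ᶠ (1 =ᶠ 5 ∧ᶠ 0 =ᶠ 6))
    (scons 0 <| scons 0 <| scons 1 <| scons 1 <| scons 3 fun _ => 0) (by simp) rfl
    (scons z <| scons z' <| scons f <| scons c fun _ => c')
  simp only [force_or, force_and, force_mem, force_eq, force_pairMem, scons_zero, scons_succ] at hg
  refine ⟨g, ?_, ?_, ?_, ?_, ?_⟩ <;> intro w' h <;> simp only [map_adj, mem_adj, hg] <;>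
    have he := he w' h <;> have hu := hu w' h <;> have hd := hd w' h <;> have hi := hi w' h <;>
    have ho := ho w' h <;> have hc := hc w' h <;> have hc' := hc' w' h <;> grind

/-- Here c' is the preimage of c and z' the preimage of z; the same f serves for both similarities.
-/
theorem Sim.of_adj {v z c : D w} (H : Sim v (INF.adj z c)) (hc : NMem c z) :
    ∃ z' c', v = INF.adj z' c' ∧ NMem c' z' ∧ Sim z' z := by
  obtain ⟨f, he, hu, hd, hi, ho⟩ := H
  simp only [map_adj, mem_adj] at he hu hd hi ho
  obtain ⟨c', hc', hp⟩ := ho w (idHom w) c (by simp [idHom_apply])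
  simp only [idHom_apply] at hc' hp
  let z' : D w := compr (0 ∈ᶠ 1 ∧ᶠ .ex (0 ∈ᶠ 3 ∧ᶠ pairMem 1 0 4))
    ⟨scons 0 <| scons 1 <| scons 1 fun _ => 3, by simp⟩ (scons v <| scons z fun _ => f)
  have hz' : ∀ (w' : W) (h : Hom w w') (x : D w'),
      x ∈ h z' ↔ x ∈ h v ∧ ∃ y ∈ h z, pair x y ∈ h f := fun w' h x => by
    simp [z', mem_map_compr]
  have hpm : ∀ (w' : W) (h : Hom w w'), h c' ∈ h v ∧ pair (h c') (h c) ∈ h f := fun w' h =>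
    ⟨mem_map h hc', by simpa using mem_map h hp⟩
  refine ⟨z', c', ext_hom fun w' h => ?_, fun w' h => ?_, f, ?_, ?_, ?_, ?_, ?_⟩ <;>
    try intro w' h
  all_goals
    simp only [map_adj, mem_adj, hz']
    have he := he w' h
    have hu := hu w' h
    have hd := hd w' h
    have hi := hi w' h
    have ho := ho w' h
    have hc := hc w' h
    have hpm := hpm w' h
    grind

theorem sim_emp : Sim (emp : D w) emp :=
  ⟨emp, by constructor <;> simp⟩

theorem Sim.eq_emp {v : D w} (H : Sim v emp) : v = emp := by
  obtain ⟨f, he, -⟩ := H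
  exact INF.eq_emp fun w' h x hx => by simpa using he w' h x hx

/-! ### Finite cardinals -/

theorem InF.zero : InF (zero : D w) := fun w' h t ht => by simpa using ht.1

theorem InF.succ {k u : D w} (hk : InF k) (hu : u ∈ succ k) : InF (succ k) := fun w' h t ht => by
  have := ht.2 w' (idHom w') (h k) (by simpa only [idHom_apply] using hk w' h t ht)
    ⟨h u, by simpa using mem_map h hu⟩
  simpa [idHom_apply] using this

/-- The closure condition of 𝔽 only ever adds inhabited successors. -/
theorem InF.nonempty {k : D w} (hk : InF k) : ∃ u, u ∈ k := by
  have : k ∈ compr (inhabited 0) ⟨fun _ => 1, by simp⟩ (fun _ => k) := by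
    refine hk.mem ⟨?_, fun w' h l _ hl => ?_⟩
    · simp [mem_compr]
    · simpa [mem_map_compr] using hl
  simpa [mem_compr] using this

/-- Induction on k: `Sim.adj` shows that members of a successor are similar, `Sim.of_adj` that sets
similar to a member are members. -/
theorem InF.sim_iff {k u v : D w} (hk : InF k) (hu : u ∈ k) : v ∈ k ↔ Sim v u := by
  have key : ∃ t : D w, ∀ (w' : W) (h : Hom w w') (k : D w'), k ∈ h t ↔
      (∀ (w₂ : W) (j : Hom w' w₂) (u v : D w₂), u ∈ j k ∧ v ∈ j k → Sim v u) ∧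
      (∀ (w₂ : W) (j : Hom w' w₂) (u v : D w₂), u ∈ j k ∧ Sim v u → v ∈ j k) := by
    refine ⟨compr (.all (.all (1 ∈ᶠ 2 ∧ᶠ 0 ∈ᶠ 2 →ᶠ similar 0 1)) ∧ᶠ
      .all (.all (1 ∈ᶠ 2 ∧ᶠ similar 0 1 →ᶠ 0 ∈ᶠ 2))) ⟨fun _ => 2, by simp⟩ (fun _ => k), ?_⟩
    intro w' h k
    simp only [mem_map_compr, force_and, force_all_all_imp, force_mem, force_similar, scons_zero,
      scons_succ]
  obtain ⟨t, ht⟩ := key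
  have hkt : k ∈ t := by
    refine hk.mem ⟨?_, fun w' h l hl _ => (ht w' h _).2 ⟨?_, ?_⟩⟩
    · have := ht w (idHom w) INF.zero
      rw [idHom_apply] at this
      refine this.2 ⟨?_, ?_⟩
      · rintro w₂ j u v ⟨hu, hv⟩
        simp only [map_zero, mem_zero] at hu hv
        rw [hu, hv]
        exact sim_emp
      · rintro w₂ j u v ⟨hu, hv⟩
        simp only [map_zero, mem_zero] at hu ⊢
        rw [hu] at hv
        exact hv.eq_emp
    · rintro w₂ j u v ⟨hu, hv⟩
      simp only [map_succ, mem_succ] at hu hv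
      obtain ⟨z, c, hz, hc, rfl⟩ := hu
      obtain ⟨z', c', hz', hc', rfl⟩ := hv
      exact (((ht w' h l).1 hl).1 w₂ j z z' ⟨hz, hz'⟩).adj hc' hc
    · rintro w₂ j u v ⟨hu, hv⟩
      simp only [map_succ, mem_succ] at hu ⊢
      obtain ⟨z, c, hz, hc, rfl⟩ := hu
      obtain ⟨z', c', rfl, hc', hs⟩ := hv.of_adj hc
      exact ⟨z', c', ((ht w' h l).1 hl).2 w₂ j z z' ⟨hz, hs⟩, hc', rfl⟩
  have := ht w (idHom w) k
  rw [idHom_apply] at this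
  obtain ⟨h₁, h₂⟩ := this.1 hkt
  have h₁ := h₁ w (idHom w) u v
  have h₂ := h₂ w (idHom w) u v
  simp only [idHom_apply] at h₁ h₂
  exact ⟨fun hv => h₁ ⟨hu, hv⟩, fun hv => h₂ ⟨hu, hv⟩⟩

/-- Finite cardinals with a common member are equal. -/
theorem InF.eq {k l u : D w} (hk : InF k) (hl : InF l) (huk : u ∈ k) (hul : u ∈ l) : k = l :=
  ext_hom fun w' h x => by
    rw [(hk.map h).sim_iff (mem_map h huk), (hl.map h).sim_iff (mem_map h hul)]

/-! ### Addition -/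

theorem add_zero (x : D w) : add x zero = x := by
  have key : ∀ {w : W} (x u : D w), u ∈ add x zero ↔ u ∈ x := by
    intro w x u
    simp only [mem_add, mem_zero]
    constructor
    · rintro ⟨a, b, ha, rfl, -, rfl⟩
      rwa [union_emp]
    · exact fun hu => ⟨u, emp, hu, rfl, disj_emp u, (union_emp u).symm⟩
  exact ext_hom fun w' h u => by simp [key]

theorem add_succ (x y : D w) : add x (succ y) = succ (add x y) := by
  have key : ∀ {w : W} (x y u : D w), u ∈ add x (succ y) ↔ u ∈ succ (add x y) := by
    intro w x y u
    simp only [mem_add, mem_succ]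
    constructor
    · rintro ⟨a, _, ha, ⟨z, c, hz, hc, rfl⟩, hd, rfl⟩
      refine ⟨union a z, c, ⟨a, z, ha, hz, fun w' h i hi => hd w' h i ?_, rfl⟩,
        fun w' h hi => ?_, union_adj a z c⟩
      · simp [hi]
      · simp only [map_union, mem_union] at hi
        exact hi.elim (fun hi => hd w' h _ ⟨hi, by simp⟩) (hc w' h)
    · rintro ⟨_, c, ⟨a, z, ha, hz, hd, rfl⟩, hc, rfl⟩
      refine ⟨a, adj z c, ha, ⟨z, c, hz, fun w' h hi => hc w' h (by simp [hi]), rfl⟩,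
        fun w' h i hi => ?_, (union_adj a z c).symm⟩
      simp only [map_adj, mem_adj] at hi
      rcases hi with ⟨h₁, h₂ | rfl⟩
      · exact hd w' h i ⟨h₁, h₂⟩
      · exact hc w' h (by simp [h₁])
  exact ext_hom fun w' h u => by simp [key]

/-- Induction on y through x + y⁺ = (x + y)⁺. The sum must be inhabited, as 𝔽 need not be closed
under successor; inhabitants of (x + y)⁺ give inhabitants of x + y. -/
theorem InF.add {x y u : D w} (hx : InF x) (hy : InF y) (hu : u ∈ add x y) : InF (add x y) := by
  have key : ∃ t : D w, ∀ (w' : W) (h : Hom w w') (y : D w'), y ∈ h t ↔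
      ∀ (w₂ : W) (j : Hom w' w₂) (s : D w₂),
        (s = INF.add (j (h x)) (j y) ∧ ∃ u, u ∈ s) → InF s := by
    refine ⟨compr (.all (isAdd 0 2 1 ∧ᶠ inhabited 0 →ᶠ memF 0)) ⟨fun _ => 2, by simp⟩
      (fun _ => x), ?_⟩
    intro w' h y
    simp only [mem_map_compr, force_and, force_all_imp, force_isAdd, force_memF, force_inhabited,
      scons_zero, scons_succ]
  obtain ⟨t, ht⟩ := key
  have hyt : y ∈ t := by
    refine hy.mem ⟨?_, fun w' h l hl _ => (ht w' h _).2 ?_⟩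
    · have := ht w (idHom w) INF.zero
      rw [idHom_apply] at this
      refine this.2 ?_
      rintro w₂ j _ ⟨rfl, -⟩
      rw [map_zero, add_zero, idHom_apply]
      exact hx.map j
    · rintro w₂ j _ ⟨rfl, u, hu⟩
      rw [map_succ, add_succ] at hu ⊢
      obtain ⟨z, _, hz, -⟩ := mem_succ.1 hu
      exact ((ht w' h l).1 hl w₂ j _ ⟨rfl, z, hz⟩).succ hu
  have := ht w (idHom w) y
  rw [idHom_apply] at this
  have := this.1 hyt w (idHom w) _ ⟨rfl, u, ?_⟩
  all_goals simpa only [idHom_apply]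

/-! ### Sets of unit subsets and of separable subsets -/

/-- `{x ∈ a : {x} ∈ b}`. -/
noncomputable def unitPart (a b : D w) : D w :=
  compr (0 ∈ᶠ 1 ∧ᶠ .ex (isSingleton 0 1 ∧ᶠ 0 ∈ᶠ 3)) ⟨scons 0 <| scons 1 fun _ => 2, by simp⟩
    (scons a fun _ => b)

@[simp] theorem mem_unitPart {a b x : D w} : x ∈ unitPart a b ↔ x ∈ a ∧ sing x ∈ b := by
  simp [unitPart, mem_compr]

@[simp] theorem map_unitPart (h : Hom v w) (a b : D v) :
    h (unitPart a b) = unitPart (h a) (h b) := by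
  simp only [unitPart, map_compr, map_scons]

theorem usc_unitPart {a b : D w} (H : Sub b (usc a)) : usc (unitPart a b) = b :=
  ext_hom fun w' h u => by
    simp only [map_usc, map_unitPart, mem_usc, mem_unitPart]
    constructor
    · rintro ⟨x, ⟨-, hx⟩, rfl⟩
      exact hx
    · intro hu
      obtain ⟨x, hx, rfl⟩ : ∃ x ∈ h a, u = sing x := by simpa using H w' h u hu
      exact ⟨x, ⟨hx, hu⟩, rfl⟩

theorem sing_mem_usc {x a : D w} : sing x ∈ usc a ↔ x ∈ a := by
  simp

theorem usc_eq_emp {a : D w} (H : usc a = emp) : a = emp :=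
  eq_emp fun w' h x hx => by
    have : sing x ∈ h (usc a) := by simpa using hx
    simp [H] at this

/-- Since x ∈ a iff {x} ∈ USC(a), a decomposition of USC(a) pulls back to one of a. -/
theorem exists_of_usc_eq_adj {a b c : D w} (H : usc a = adj b c) (hc : NMem c b) :
    ∃ a' d, a = adj a' d ∧ NMem d a' ∧ b = usc a' := by
  have hcu : c ∈ usc a := by simp [H]
  obtain ⟨d, hd, rfl⟩ := mem_usc.1 hcu
  refine ⟨unitPart a b, d, ext_hom fun w' h x => ?_, fun w' h => ?_, (usc_unitPart ?_).symm⟩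
  · have : sing x ∈ h (usc a) ↔ sing x ∈ h (adj b (sing d)) := by rw [H]
    simp only [map_usc, map_adj, sing_mem_usc, mem_adj, map_sing, sing_inj] at this
    have hd := mem_map h hd
    simp only [map_adj, map_unitPart, mem_adj, mem_unitPart]
    grind
  · have := hc w' h
    rw [map_sing] at this
    simp [this]
  · intro w' h x hx
    rw [H]
    simp [hx]

theorem exists_of_usc_eq_union {a b c : D w} (H : usc a = union b c) (hd : Disj b c) :
    ∃ a₁ a₂, b = usc a₁ ∧ c = usc a₂ ∧ a = union a₁ a₂ ∧ Disj a₁ a₂ := by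
  refine ⟨unitPart a b, unitPart a c, (usc_unitPart ?_).symm, (usc_unitPart ?_).symm,
    ext_hom fun w' h x => ?_, fun w' h x => ?_⟩
  · intro w' h x hx
    rw [H]
    simp [hx]
  · intro w' h x hx
    rw [H]
    simp [hx]
  · have : sing x ∈ h (usc a) ↔ sing x ∈ h (union b c) := by rw [H]
    simp only [map_usc, map_union, sing_mem_usc, mem_union] at this
    simp only [map_union, map_unitPart, mem_union, mem_unitPart]
    grind
  · have := hd w' h (sing x)
    simp only [map_unitPart, mem_unitPart]
    grind

/-- `a ∩ b`. -/
noncomputable def inter (a b : D w) : D w :=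
  compr (0 ∈ᶠ 1 ∧ᶠ 0 ∈ᶠ 2) ⟨scons 0 fun _ => 1, by simp⟩ (scons a fun _ => b)

@[simp] theorem mem_inter {a b x : D w} : x ∈ inter a b ↔ x ∈ a ∧ x ∈ b := by
  simp [inter, mem_compr]

@[simp] theorem map_inter (h : Hom v w) (a b : D v) : h (inter a b) = inter (h a) (h b) := by
  simp only [inter, map_compr, map_scons]

/-- `{u ∪ v : u ∈ a, v ∈ b}`. -/
noncomputable def unions (a b : D w) : D w :=
  compr (.ex (.ex (1 ∈ᶠ 3 ∧ᶠ 0 ∈ᶠ 4 ∧ᶠ isUnion 2 1 0))) ⟨scons 1 fun _ => 2, by simp⟩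
    (scons a fun _ => b)

/-- `z` is `{u ∪ v : u ∈ a, v ∈ b}`. -/
def isUnions (z a b : ℕ) : Fml :=
  .all (0 ∈ᶠ (z + 1) ↔ᶠ .ex (.ex (1 ∈ᶠ (a + 3) ∧ᶠ 0 ∈ᶠ (b + 3) ∧ᶠ isUnion 2 1 0)))

@[simp] theorem mem_unions {a b x : D w} :
    x ∈ unions a b ↔ ∃ u v, u ∈ a ∧ v ∈ b ∧ x = union u v := by
  simp [unions, mem_compr]

@[simp] theorem map_unions (h : Hom v w) (a b : D v) : h (unions a b) = unions (h a) (h b) := by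
  simp only [unions, map_compr, map_scons]

@[simp] theorem force_isUnions (z a b : ℕ) (σ : ℕ → D w) :
    Force (isUnions z a b) σ ↔ σ z = unions (σ a) (σ b) := by
  rw [isUnions, force_all_iff, eq_iff_forall_mem]
  simp

@[simp] theorem stratBy_isUnions {σ : ℕ → ℕ} (z a b : ℕ) :
    (isUnions z a b).StratBy σ ↔ ∃ j, σ z = j + 2 ∧ σ a = j + 2 ∧ σ b = j + 2 := by
  simp [isUnions]

theorem unions_emp (a : D w) : unions a emp = emp := eq_emp fun w' h x => by simp

theorem unions_adj (a b c : D w) : unions a (adj b c) = union (unions a b) (unions a (sing c)) :=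
  ext_hom fun w' h x => by
    simp only [map_unions, map_adj, map_union, mem_unions, mem_adj, mem_union, map_sing, mem_sing]
    grind

/-- The map u ∪ c ↦ u is well defined because c, being disjoint from u, can be cancelled. -/
theorem sim_unions_sing {a c : D w}
    (H : ∀ (w' : W) (h : Hom w w') (u : D w'), u ∈ h a → Disj u (h c)) :
    Sim (unions a (sing c)) a := by
  obtain ⟨f, hf⟩ := exists_graph (0 ∈ᶠ 2 ∧ᶠ isUnion 1 0 3)
    (scons 1 <| scons 1 <| scons 2 fun _ => 1) (by simp) rfl (scons a fun _ => c)
  simp only [force_and, force_mem, force_isUnion, scons_zero, scons_succ] at hf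
  refine ⟨f, ?_, ?_, ?_, ?_, ?_⟩ <;> intro w' h <;>
    simp only [map_unions, map_sing, mem_unions, mem_sing, hf]
  · rintro _ ⟨u, _, hu, rfl, rfl⟩
    exact ⟨u, hu, hu, rfl⟩
  · rintro x y y' - hy hy' ⟨-, h₁⟩ ⟨-, h₂⟩
    exact union_right_cancel (H w' h y hy) (H w' h y' hy') (h₁.symm.trans h₂)
  · rintro x y hy ⟨-, hx⟩
    exact ⟨y, _, hy, rfl, hx⟩
  · rintro x x' y - - - ⟨-, h₁⟩ ⟨-, h₂⟩
    exact h₁.trans h₂.symm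
  · rintro y hy
    exact ⟨_, ⟨y, _, hy, rfl, rfl⟩, hy, rfl⟩

theorem ssc_emp : ssc (emp : D w) = sing emp :=
  ext_hom fun w' h x => by
    simp only [map_ssc, map_emp, map_sing, mem_ssc, mem_sing, not_mem_emp, false_implies,
      implies_true, and_true]
    refine ⟨fun hs => eq_emp fun u k y hy => by simpa using hs u k y hy, fun hx u k y hy => ?_⟩
    simp [hx] at hy

theorem emp_mem_ssc (a : D w) : emp ∈ ssc a :=
  mem_ssc.2 ⟨fun w' h x => by simp, fun w' h x _ => .inr (by simpa using nmem_emp x)⟩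

theorem inter_mem_ssc {u a b : D w} (hu : u ∈ ssc b) (hs : Sub a b) : inter u a ∈ ssc a := by
  refine mem_ssc.2 ⟨fun w' h x hx => ?_, fun w' h x hx => ?_⟩
  · simp only [map_inter, mem_inter] at hx
    exact hx.2
  · simp only [map_inter, mem_inter]
    refine ((mem_ssc.1 hu).2 w' h x (hs w' h x hx)).imp (fun h => ⟨h, hx⟩) fun hn => ?_
    refine hn.of_sub fun w₂ k y hy => ?_
    simp only [map_inter, mem_inter] at hy
    exact hy.1

theorem union_mem_ssc {u₁ u₂ a₁ a₂ : D w} (hd : Disj a₁ a₂) (h₁ : u₁ ∈ ssc a₁)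
    (h₂ : u₂ ∈ ssc a₂) : union u₁ u₂ ∈ ssc (union a₁ a₂) := by
  obtain ⟨hs₁, h₁⟩ := mem_ssc.1 h₁
  obtain ⟨hs₂, h₂⟩ := mem_ssc.1 h₂
  refine mem_ssc.2 ⟨fun w' h x hx => ?_, fun w' h x hx => ?_⟩
  · simp only [map_union, mem_union] at hx ⊢
    exact hx.imp (hs₁ w' h x) (hs₂ w' h x)
  · simp only [map_union, mem_union] at hx ⊢
    rcases hx with hx | hx
    · refine (h₁ w' h x hx).imp .inl fun hn w₂ k hk => ?_
      simp only [map_union, mem_union] at hk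
      rcases hk with hk | hk
      · exact hn w₂ k hk
      · exact (hd.map h) w₂ k _ ⟨mem_map k hx, (hs₂.map h) w₂ k _ hk⟩
    · refine (h₂ w' h x hx).imp .inr fun hn w₂ k hk => ?_
      simp only [map_union, mem_union] at hk
      rcases hk with hk | hk
      · exact (hd.map h) w₂ k _ ⟨(hs₁.map h) w₂ k _ hk, mem_map k hx⟩
      · exact hn w₂ k hk

/-- A separable u is the union of its traces on a₁ and a₂. Conversely, disjointness prevents one
part of a union from affecting decidability on the other side. -/
theorem unions_ssc {a₁ a₂ : D w} (hd : Disj a₁ a₂) :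
    unions (ssc a₁) (ssc a₂) = ssc (union a₁ a₂) := by
  have key : ∀ {w : W} {a₁ a₂ : D w}, Disj a₁ a₂ → ∀ u,
      u ∈ unions (ssc a₁) (ssc a₂) ↔ u ∈ ssc (union a₁ a₂) := by
    intro w a₁ a₂ hd u
    rw [mem_unions]
    constructor
    · rintro ⟨u₁, u₂, h₁, h₂, rfl⟩
      exact union_mem_ssc hd h₁ h₂
    · intro hu
      refine ⟨inter u a₁, inter u a₂, inter_mem_ssc hu fun w' h x hx => by simp [hx],
        inter_mem_ssc hu fun w' h x hx => by simp [hx], ext_hom fun w' h x => ?_⟩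
      have := (mem_ssc.1 hu).1 w' h x
      simp only [map_union, mem_union, map_inter, mem_inter] at this ⊢
      grind
  exact ext_hom fun w' h u => by simpa only [map_unions, map_ssc, map_union] using key (hd.map h) u

/-- Separability decides whether c ∈ u, which fixes u. Arbitrary subsets of {c} could be more
numerous intuitionistically. -/
theorem ssc_sing (c : D w) : ssc (sing c) = adj (sing emp) (sing c) := by
  have key : ∀ {w : W} (c u : D w), u ∈ ssc (sing c) ↔ u ∈ adj (sing emp) (sing c) := by
    intro w c u
    rw [mem_ssc, mem_adj, mem_sing]
    constructor
    · rintro ⟨hs, hu⟩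
      have := hu w (idHom w) c (by simp [idHom_apply])
      rw [idHom_apply] at this
      rcases this with h | h
      · refine .inr (hs.antisymm fun w' k x hx => ?_)
        simp only [map_sing, mem_sing] at hx
        exact hx ▸ mem_map k h
      · refine .inl (eq_emp fun w' k x hx => h w' k ?_)
        have := hs w' k x hx
        simp only [map_sing, mem_sing] at this
        exact this ▸ hx
    · rintro (rfl | rfl)
      · exact mem_ssc.1 (emp_mem_ssc _)
      · exact ⟨fun w' h x hx => hx, fun w' h x hx => .inl hx⟩
  exact ext_hom fun w' h u => by simpa using key (h c) u

end Arithmetic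

/-! ### Powers of two and their products -/

section Exponentiation

variable {W : Type} [Kripke W] [KripkeModel theory W] {v w : W}

theorem unions_sing_emp (a : D w) : unions a (sing emp) = a :=
  ext_hom fun w' h x => by simp [union_emp]

theorem disj_sing {u a c : D w} (hs : Sub u a) (hc : NMem c a) : Disj u (sing c) :=
  fun w' h x hx => by
    simp only [map_sing, mem_sing] at hx
    exact hc w' h (hx.2 ▸ hs w' h x hx.1)

theorem ssc_adj {a c : D w} (hc : NMem c a) :
    ssc (adj a c) = union (ssc a) (unions (ssc a) (sing (sing c))) := by
  have hd : Disj a (sing c) := disj_sing (fun _ _ _ h => h) hc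
  have : adj a c = union a (sing c) := ext_hom fun w' h x => by simp
  rw [this, ← unions_ssc hd, ssc_sing, unions_adj, unions_sing_emp]

theorem disj_ssc_unions {a c : D w} (hc : NMem c a) :
    Disj (ssc a) (unions (ssc a) (sing (sing c))) := by
  rintro w' h x ⟨h₁, h₂⟩
  simp only [map_ssc, map_unions, map_sing, mem_unions, mem_sing] at h₁ h₂
  obtain ⟨u, _, -, rfl, rfl⟩ := h₂
  exact (hc.map h).not_mem ((mem_ssc.1 h₁).1.mem (by simp))

theorem InF.unions_sing_mem {a b c k : D w} (hk : InF k) (ha : ssc a ∈ k) (hd : Disj a b)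
    (hc : Sub c b) : unions (ssc a) (sing c) ∈ k := by
  refine (hk.sim_iff ha).2 (sim_unions_sing fun w' h u hu => ?_)
  rw [map_ssc] at hu
  exact fun w₂ j x hx => hd.map h w₂ j x ⟨(mem_ssc.1 hu).1 w₂ j x hx.1, hc.map h w₂ j x hx.2⟩

/-- The separable subsets without c and those with c form two disjoint copies of SSC(a). -/
theorem InF.ssc_adj_mem {a c k : D w} (hk : InF k) (ha : ssc a ∈ k) (hc : NMem c a) :
    ssc (INF.adj a c) ∈ INF.add k k := by
  rw [ssc_adj hc]
  exact mem_add.2 ⟨_, _, ha, hk.unions_sing_mem ha (disj_sing (fun _ _ _ h => h) hc)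
    (fun _ _ _ h => h), disj_ssc_unions hc, rfl⟩

/-- The separable subsets of the sets `a` with `USC(a)` in a finite cardinal form finite sets of
one and the same cardinal. -/
theorem InF.exists_ssc_mem {p a : D w} (hp : InF p) (ha : usc a ∈ p) :
    ∃ k, InF k ∧ ∀ (w' : W) (h : Hom w w') (b : D w'), usc b ∈ h p → ssc b ∈ h k := by
  -- One k has to serve all b, at all later worlds, for the induction to go through; k and p receive
  -- the same index.
  have key : ∃ t : D w, ∀ (w' : W) (h : Hom w w') (p : D w'), p ∈ h t ↔
      ∀ (w₂ : W) (j : Hom w' w₂) (a : D w₂), usc a ∈ j p → ∃ k, InF k ∧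
        ∀ (w₃ : W) (i : Hom w₂ w₃) (b : D w₃), usc b ∈ i (j p) → ssc b ∈ i k := by
    refine ⟨compr (.all (.ex (isUSC 0 1 ∧ᶠ 0 ∈ᶠ 2) →ᶠ .ex (memF 0 ∧ᶠ
      .all (.ex (isUSC 0 1 ∧ᶠ 0 ∈ᶠ 4) →ᶠ .ex (isSSC 0 1 ∧ᶠ 0 ∈ᶠ 2)))))
      ⟨fun _ => 3, by simp⟩ (fun _ => p), ?_⟩
    intro w' h p
    simp only [mem_map_compr, force_and, force_all_imp, force_ex, force_isUSC, force_isSSC,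
      force_memF, force_mem, scons_zero, scons_succ, exists_eq_left]
  obtain ⟨t, ht⟩ := key
  have hpt : p ∈ t := by
    refine hp.mem ⟨?_, fun w' h l hl _ => (ht w' h _).2 ?_⟩
    · have := ht w (idHom w) INF.zero
      rw [idHom_apply] at this
      refine this.2 fun w₂ j a _ => ?_
      have h₀ : ∀ u : W, sing emp ∈ INF.succ (INF.zero : D u) := fun u =>
        mem_succ.2 ⟨emp, emp, by simp, nmem_emp _, ext_hom fun w' h x => by simp⟩
      refine ⟨INF.succ INF.zero, InF.zero.succ (h₀ _), fun w₃ i b hb => ?_⟩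
      simp only [map_zero, mem_zero, map_succ] at hb ⊢
      rw [usc_eq_emp hb, ssc_emp]
      exact h₀ _
    · intro w₂ j a ha
      have hl := (ht w' h l).1 hl w₂ j
      rw [map_succ] at ha ⊢
      obtain ⟨z, c, hz, hc, he⟩ := mem_succ.1 ha
      obtain ⟨a, d, rfl, hd, rfl⟩ := exists_of_usc_eq_adj he hc
      obtain ⟨k, hk, H⟩ := hl a hz
      have ha' : ssc a ∈ k := by
        simpa only [idHom_apply] using
          H w₂ (idHom w₂) a (by simpa only [idHom_apply] using hz)
      refine ⟨INF.add k k, hk.add hk (hk.ssc_adj_mem ha' hd), fun w₃ i b hb => ?_⟩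
      rw [map_succ] at hb
      obtain ⟨z, c, hz, hc, he⟩ := mem_succ.1 hb
      obtain ⟨b, d, rfl, hd, rfl⟩ := exists_of_usc_eq_adj he hc
      rw [map_add]
      exact (hk.map i).ssc_adj_mem (H w₃ i b hz) hd
  have := ht w (idHom w) p
  rw [idHom_apply] at this
  have := this.1 hpt w (idHom w) a
  simp only [idHom_apply] at this
  exact this ha

/-- The k of `InF.exists_ssc_mem` is 2^p itself, as it is the similarity class of SSC(a). -/
theorem InF.exp_of_usc_mem {p a : D w} (hp : InF p) (ha : usc a ∈ p) :
    InF (exp p) ∧ ssc a ∈ exp p := by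
  obtain ⟨k, hk, H⟩ := hp.exists_ssc_mem ha
  have hak : ssc a ∈ k := by
    simpa only [idHom_apply] using H w (idHom w) a (by simpa only [idHom_apply] using ha)
  obtain rfl : exp p = k := by
    refine ext_hom fun w' h u => ?_
    rw [map_exp, mem_exp]
    constructor
    · rintro ⟨b, hb, hu⟩
      exact ((hk.map h).sim_iff (H w' h b hb)).2 hu
    · intro hu
      have ha' : usc (h a) ∈ h p := by simpa using mem_map h ha
      exact ⟨h a, ha', ((hk.map h).sim_iff (H w' h _ ha')).1 hu⟩
  exact ⟨hk, hak⟩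

/-! ### Multiplication -/

theorem InG.zero_right {x : D w} (hx : InSF x) : InG x zero zero := fun w' h t ht => by
  simpa [idHom_apply] using ht.zero_right w' (idHom w') (h x) (hx.map h)

theorem InG.succ_right {x y z : D w} (hz : InG x y z) : InG x (succ y) (add z x) :=
  fun w' h t ht => by
    have := ht.succ_right w' (idHom w') (h x) (h y) (h z)
      (by simpa only [idHom_apply] using hz w' h t ht)
    simpa [idHom_apply] using this

theorem InSF.exists_inG {x y : D w} (hx : InSF x) (hy : InSF y) : ∃ z, InG x y z := by
  have key : y ∈ compr (.ex (memG 2 1 0)) ⟨fun _ => 2, by simp [memG]⟩ (fun _ => x) := by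
    refine hy.mem ⟨?_, fun w' h k => ?_⟩
    · simp only [mem_compr, force_ex, force_memG, scons_zero, scons_succ]
      exact ⟨_, .zero_right hx⟩
    · simp only [mem_map_compr, force_ex, force_memG, scons_zero, scons_succ]
      exact fun ⟨z, hz⟩ => ⟨_, hz.succ_right⟩
  simpa [mem_compr] using key

/-- The successor step of multiplication: adjoining c to b adds the translate of SSC(a₁) by c, a
copy of SSC(a₁) disjoint from the earlier unions. -/
theorem InF.unions_adj_mem {a₁ a₂ b c x z : D w} (hd : Disj a₁ a₂) (hx : InF x)
    (hax : ssc a₁ ∈ x) (hb : Sub (INF.adj b c) (ssc a₂)) (hc : NMem c b) (hz : InF z)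
    (hbz : unions (ssc a₁) b ∈ z) :
    InF (INF.add z x) ∧ unions (ssc a₁) (INF.adj b c) ∈ INF.add z x := by
  have hc₂ : Sub c a₂ := (mem_ssc.1 (hb.mem (by simp))).1
  have hm : unions (ssc a₁) (INF.adj b c) ∈ INF.add z x := by
    rw [unions_adj]
    refine mem_add.2 ⟨_, _, hbz, hx.unions_sing_mem hax hd hc₂, fun w' h u hu => ?_, rfl⟩
    simp only [map_unions, map_sing, map_ssc, mem_unions, mem_sing] at hu
    obtain ⟨⟨u₁, v₁, hu₁, hv₁, rfl⟩, u₂, _, hu₂, rfl, he⟩ := hu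
    have hv : Sub v₁ (h a₂) := (mem_ssc.1 (by simpa using hb w' h v₁ (by simp [hv₁]))).1
    -- Equal unions have equal parts inside a₂; a common member would therefore force c ∈ b.
    have key : ∀ {u u' v v' : D w'}, u ∈ ssc (h a₁) → Sub v' (h a₂) → union u' v' = union u v →
        Sub v' v := by
      intro u u' v v' hu hv' he w₂ j x hx
      have : x ∈ j (union u' v') := by simp [hx]
      rw [he, map_union, mem_union] at this
      exact this.resolve_left fun hxu =>
        (hd.map h) w₂ j x ⟨(mem_ssc.1 hu).1 w₂ j x hxu, hv' w₂ j x hx⟩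
    have : v₁ = h c := (key hu₂ hv he).antisymm (key hu₁ (hc₂.map h) he.symm)
    exact hc w' h (this ▸ hv₁)
  exact ⟨hz.add hx hm, hm⟩

/-- In a product `z` of the cardinals of `SSC(a₁)` and of a subset `b` of `SSC(a₂)`, with disjoint
`a₁` and `a₂`, there is the set of all unions of members of `SSC(a₁)` and `b`. -/
theorem InG.unions_mem {a₁ a₂ b x y z : D w} (hd : Disj a₁ a₂) (hx : InF x) (hax : ssc a₁ ∈ x)
    (hz : InG x y z) (hby : b ∈ y) (hb : Sub b (ssc a₂)) : InF z ∧ unions (ssc a₁) b ∈ z := by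
  have key : ∃ t : D w, ∀ (w' : W) (h : Hom w w') (r : D w'), r ∈ h t ↔
      ∀ (w₂ : W) (j : Hom w' w₂) (y z b : D w₂), (j r = triple (j (h x)) y z ∧ b ∈ y ∧
        Sub b (j (h (ssc a₂)))) → InF z ∧ unions (j (h (ssc a₁))) b ∈ z := by
    refine ⟨compr (.all (.all (.all (isTriple 3 4 2 1 ∧ᶠ 0 ∈ᶠ 2 ∧ᶠ subset 0 6 →ᶠ
      memF 1 ∧ᶠ .ex (isUnions 0 6 1 ∧ᶠ 0 ∈ᶠ 2)))))
      ⟨scons 7 <| scons 3 <| fun _ => 2, 3, 3, 2, by simp⟩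
      (scons x <| scons (ssc a₁) fun _ => ssc a₂), ?_⟩
    intro w' h p
    simp only [mem_map_compr, force_and, force_all_all_all_imp, force_ex, force_isTriple,
      force_subset, force_isUnions, force_memF, force_mem, scons_zero, scons_succ, exists_eq_left]
  obtain ⟨t, ht⟩ := key
  simp only [map_ssc] at ht
  have hm : MulClosed t := by
    refine ⟨fun w' h r _ => (ht w' h _).2 ?_, fun w' h r _ => (ht w' h _).2 ?_,
      fun w' h r y z hr => (ht w' h _).2 ?_⟩
    · rintro w₂ j y z b ⟨he, hby, -⟩
      simp only [map_triple, map_zero, triple_inj] at he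
      obtain ⟨-, rfl, rfl⟩ := he
      rw [mem_zero] at hby
      rw [hby, unions_emp, mem_zero]
      exact ⟨InF.zero, rfl⟩
    -- The triples ⟨zero, r, zero⟩ do not matter: x = zero would make SSC(a₁) empty, but Λ belongs
    -- to it.
    · rintro w₂ j y z b ⟨he, -, -⟩
      simp only [map_triple, map_zero, triple_inj] at he
      have h₁ := mem_map j (mem_map h hax)
      rw [← he.1, mem_zero, map_ssc, map_ssc] at h₁
      have h₂ := emp_mem_ssc (j (h a₁))
      rw [h₁] at h₂
      exact absurd h₂ (not_mem_emp _)
    · rintro w₂ j y' z' b ⟨he, hby, hb⟩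
      simp only [map_triple, map_succ, map_add, triple_inj] at he
      obtain ⟨hrx, rfl, rfl⟩ := he
      obtain ⟨b, c, hby', hc, rfl⟩ := mem_succ.1 hby
      have := (ht w' h _).1 hr w₂ j (j y) (j z) b ⟨by rw [map_triple, hrx], hby',
        fun w₃ i u hu => hb w₃ i u (by simp [hu])⟩
      rw [hrx]
      refine InF.unions_adj_mem ((hd.map h).map j) ((hx.map h).map j) ?_ hb hc this.1 this.2
      simpa using mem_map j (mem_map h hax)
  have := ht w (idHom w) (triple x y z)
  simp only [idHom_apply] at this
  have := this.1 (hz.mem hm) w (idHom w) y z b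
  simp only [idHom_apply] at this
  exact this ⟨trivial, hby, hb⟩

/-- Exponents add: `2 ^ (p + q) = 2 ^ p · 2 ^ q`. -/
theorem exp_add {p q : D w} (hp : InF p) (hq : InF q) (hs : InF (add p q))
    (he : InF (exp (add p q))) :
    InF (exp p) ∧ InF (exp q) ∧ InF (mul (exp p) (exp q)) ∧
      exp (add p q) = mul (exp p) (exp q) := by
  obtain ⟨u, hu⟩ := he.nonempty
  obtain ⟨a, ha, -⟩ := mem_exp.1 hu
  obtain ⟨_, _, hp', hq', hd, hab⟩ := mem_add.1 ha
  obtain ⟨a₁, a₂, rfl, rfl, rfl, hd⟩ := exists_of_usc_eq_union hab hd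
  obtain ⟨hep, h₁⟩ := hp.exp_of_usc_mem hp'
  obtain ⟨heq, h₂⟩ := hq.exp_of_usc_mem hq'
  have h₃ := (hs.exp_of_usc_mem ha).2
  rw [← unions_ssc hd] at h₃
  -- Uniqueness of the product value, from the shared member SSC(a₁ ∪ a₂) of two finite cardinals.
  have key : ∀ {w' : W} (h : Hom w w') {z : D w'}, InG (exp (h p)) (exp (h q)) z →
      exp (add (h p) (h q)) = z := by
    intro w' h z hz
    have h₁ := mem_map h h₁
    have h₂ := mem_map h h₂
    have h₃ := mem_map h h₃
    have hep := hep.map h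
    have he := he.map h
    simp only [map_exp, map_ssc, map_unions, map_add] at h₁ h₂ h₃ hep he
    obtain ⟨hz, hm⟩ := hz.unions_mem (hd.map h) hep h₁ h₂ fun _ _ _ h => h
    exact he.eq hz h₃ hm
  have hm : exp (add p q) = mul (exp p) (exp q) := by
    refine ext_hom fun w' h u => ?_
    rw [map_mul, map_exp, map_exp, map_exp, map_add, mem_mul]
    have hep := (hep.map h).inSF
    have heq := (heq.map h).inSF
    rw [map_exp] at hep heq
    constructor
    · intro hu
      obtain ⟨z, hz⟩ := hep.exists_inG heq
      exact ⟨z, hz, key h hz ▸ hu⟩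
    · rintro ⟨z, hz, hu⟩
      exact key h hz ▸ hu
  exact ⟨hep, heq, hm ▸ he, hm⟩

end Exponentiation

end INF

/-- The language has no terms, so the five sets are bound existentially; they are unique by
extensionality, and their existence is part of the claim. The variables 6 down to 0 are p, q, p+q,
2^(p+q), 2^p, 2^q and 2^p · 2^q. -/
theorem mainTheorem7 :
    INF.Provable (.all (.all (.ex (.ex (.ex (.ex (.ex (
      (INF.isAdd 4 6 5 ∧ᶠ INF.isExp 3 4 ∧ᶠ INF.isExp 2 6 ∧ᶠ INF.isExp 1 5 ∧ᶠ INF.isMul 0 2 1) ∧ᶠ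
      (INF.memF 6 ∧ᶠ INF.memF 5 ∧ᶠ INF.memF 4 ∧ᶠ INF.memF 3 →ᶠ
        INF.memF 2 ∧ᶠ INF.memF 1 ∧ᶠ INF.memF 0 ∧ᶠ 3 =ᶠ 0))))))))) := by
  refine INF.proves_of_force fun W _ _ w σ => (INF.force_all_all _ _).2 fun w' h p q => ?_
  refine ⟨INF.add p q, INF.exp (INF.add p q), INF.exp p, INF.exp q,
    INF.mul (INF.exp p) (INF.exp q), by simp, fun w₂ k H => ?_⟩
  simp only [INF.force_and, INF.force_memF, INF.force_eq, INF.scons_zero, INF.scons_succ,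
    INF.map_add, INF.map_exp, INF.map_mul] at H ⊢
  exact INF.exp_add H.1 H.2.1 H.2.2.1 H.2.2.2
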